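/- Let $T>0$, $0\le\alpha<2$, $\beta,\mu\in\mathbb R$ with $\alpha+\beta\neq1$ and $\mu<\mu(\alpha+\beta)$, where $\mu(\delta)=(1-\delta)^2/4$, and let $r\in\{0,1\}$. Put $\ell=0$ if $\alpha+\beta<1$ and $\ell=1$ if $\alpha+\beta>1$, $$\gamma=\tfrac{1-\alpha-\beta}{2}-\sqrt{\mu(\alpha+\beta)-\mu},\qquad \kappa=\tfrac{2-\alpha}{2},\qquad \nu=\sqrt{\mu(\alpha+\beta)-\mu}\,/\kappa .$$ Let $\mathcal A u=-(x^\alpha u_x)_x-\beta x^{\alpha-1}u_x-\mu x^{\alpha-2}u$ on $(0,1)$, let $0<j_{\nu,1}<j_{\nu,2}<\dots$ be the positive zeros of the Bessel function $J_\nu$, and let $$\lambda_k=\kappa^2j_{\nu,k}^2,\qquad \Phi_k(x)=\frac{(2\kappa)^{1/2}}{|J_\nu'(j_{\nu,k})|}\,x^{(1-\alpha-\beta)/2}J_\nu(j_{\nu,k}x^{\kappa}),\qquad k\ge1,$$ in $L^2_\beta(0,1)=L^2((0,1);x^\beta dx)$ (real-valued). For $s\ge0$ let $\mathcal H^s=\{u=\sum_k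 a_k\Phi_k\in L^2_\beta(0,1):\|u\|_{\mathcal H^s}^2=\sum_k|a_k|^2\lambda_k^{2s}<\infty\}$, where $a_k=\langle u,\Phi_k\rangle_\beta$, and let $\mathcal H^{-s}$ be the dual of $\mathcal H^s$ with respect to the pivot space $L^2_\beta(0,1)$. In $\mathcal H^{s}$ and in $\mathcal H^{-s}$ put $S(t)\sum_k a_k\Phi_k=\sum_k e^{-\lambda_k^2t}a_k\Phi_k$, $t\ge0$, and write $\mathcal O_\delta(z)=\lim_{x\to0^+}x^\delta z(x)$. Let $s>0$ satisfy $s>(\nu+1)/2-r$, and let $u_0\in\mathcal H^{-s}$ and $f\in L^2(0,T)$. Then, for each $\tau\in[0,T]$, the formula $$\langle u(\tau),z\rangle_{\mathcal H^{-s},\mathcal H^s}=\langle u_0,S(\tau)z\rangle_{\mathcal H^{-s},\mathcal H^s}+(-1)^{1-\ell}\int_0^\tau f(t)\,\mathcal O_{\alpha+\beta+\gamma-\ell}\bigl(\partial_x^{1-\ell}[\mathcal A^{1-r}S(\tau-t)z]\bigr)\,dt\quad\text{for all }z\in\mathcal H^s\tag{1}$$ (in which the boundary values exist for $0<t<\tau$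 and the integrand is integrable) defines a unique element $u(\tau)\in\mathcal H^{-s}$, and $$u(\tau)=S(\tau)u_0+(-1)^{1-\ell}B_{\ell r}(\tau)f,$$ where $B_{\ell r}(\tau):L^2(0,T)\to\mathcal H^{-s}$, $\tau\in[0,T]$, is the strongly continuous family of bounded linear operators given by $$\langle B_{\ell r}(\tau)f,z\rangle_{\mathcal H^{-s},\mathcal H^s}=\int_0^\tau f(t)\,\mathcal O_{\alpha+\beta+\gamma-\ell}\bigl(\partial_x^{1-\ell}[\mathcal A^{1-r}S(\tau-t)z]\bigr)\,dt\quad\text{for all }z\in\mathcal H^s .$$ Moreover, $u$ belongs to $C^0([0,T];\mathcal H^{-s})$ and is the unique weak solution, i.e. the unique function in $C^0([0,T];\mathcal H^{-s})$ satisfying (1) for all $\tau\in(0,T]$, and there is a constant $C$, independent of $u_0$ and $f$, such that $$\|u\|_{L^\infty([0,T];\mathcal H^{-s})}\le C\bigl(\|u_0\|_{\mathcal H^{-s}}+\|f\|_{L^2(0,T)}\bigr).$$ -/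

import Mathlib

open MeasureTheory Filter Topology Set

namespace DegenerateFourthOrder

noncomputable section

/-! ### Parameters -/

/-- The critical constant `μ(δ) = (1 - δ)² / 4`. -/
def muCrit (δ : ℝ) : ℝ := (1 - δ) ^ 2 / 4

/-- `κ_α = (2 - α) / 2`. -/
def kappa (α : ℝ) : ℝ := (2 - α) / 2

/-- `ν = √(μ(α+β) - μ) / κ_α`. -/
def nu (α β μ : ℝ) : ℝ := Real.sqrt (muCrit (α + β) - μ) / kappa α

/-- `γ = (1 - α - β) / 2 - √(μ(α+β) - μ)`. -/
def gam (α β μ : ℝ) : ℝ := (1 - α - β) / 2 - Real.sqrt (muCrit (α + β) - μ)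

/-- `ℓ = 0` if `α + β < 1` and `ℓ = 1` if `α + β > 1` (the case `α + β = 1` is excluded in the
theorem). -/
def ell (α β : ℝ) : ℕ := if α + β < 1 then 0 else 1

/-! ### Bessel functions of the first kind and their positive zeros -/

/-- The `m`-th term of the series of the Bessel function of the first kind. -/
def besselTerm (ν : ℝ) (m : ℕ) (x : ℝ) : ℝ :=
  (-1) ^ m / ((m.factorial : ℝ) * Real.Gamma (m + ν + 1)) * (x / 2) ^ (2 * (m : ℝ) + ν)

/-- The Bessel function of the first kind `J_ν`, for `ν ≥ 0` and `x ≥ 0`. -/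
def besselJ (ν x : ℝ) : ℝ := ∑' m : ℕ, besselTerm ν m x

/-- The increasing enumeration of the positive zeros of `J_ν`; the index starts at `0`, so that
`besselZero ν k` is the zero usually called `j_{ν,k+1}`. -/
def besselZero (ν : ℝ) : ℕ → ℝ
  | 0 => sInf {x : ℝ | 0 < x ∧ besselJ ν x = 0}
  | k + 1 => sInf {x : ℝ | besselZero ν k < x ∧ besselJ ν x = 0}

/-! ### The weighted space `L²_β(0,1)`, eigenvalues and eigenfunctions -/

/-- The measure `x^β dx` on `(0,1)`. -/
def weightedMeasure (β : ℝ) : Measure ℝ :=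
  (volume.restrict (Ioo (0 : ℝ) 1)).withDensity (fun x => ENNReal.ofReal (x ^ β))

/-- `L²_β(0,1) = L²((0,1); x^β dx)`, a real Hilbert space. -/
abbrev L2w (β : ℝ) : Type := Lp ℝ 2 (weightedMeasure β)

/-- `λ_k = κ_α² j_{ν,k}²` (index starting at `0`). -/
def eigenvalue (α β μ : ℝ) (k : ℕ) : ℝ := kappa α ^ 2 * besselZero (nu α β μ) k ^ 2

/-- The function
`Φ_k(x) = (2κ_α)^{1/2} / |J_ν'(j_{ν,k})| · x^{(1-α-β)/2} · J_ν(j_{ν,k} x^{κ_α})`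
(index starting at `0`). -/
def eigenfun (α β μ : ℝ) (k : ℕ) (x : ℝ) : ℝ :=
  Real.sqrt (2 * kappa α) / |deriv (besselJ (nu α β μ)) (besselZero (nu α β μ) k)| *
    x ^ ((1 - α - β) / 2) * besselJ (nu α β μ) (besselZero (nu α β μ) k * x ^ kappa α)

open scoped Classical in
/-- `Φ_k` as an element of `L²_β(0,1)`. The `else` branch is never used when `α < 2`,
see `memLp_eigenfun` below. -/
def eigenvec (α β μ : ℝ) (k : ℕ) : L2w β :=
  if h : MemLp (eigenfun α β μ k) 2 (weightedMeasure β) then h.toLp else 0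

theorem gamma_le_gamma_add {ν : ℝ} (hν : 0 ≤ ν) (m : ℕ) :
    Real.Gamma (ν + 1) ≤ Real.Gamma (m + ν + 1) := by
  induction m with
  | zero => simp
  | succ m ih =>
    have hm : (0 : ℝ) ≤ m := Nat.cast_nonneg m
    have h1 : Real.Gamma ((m : ℝ) + ν + 1 + 1) = (m + ν + 1) * Real.Gamma (m + ν + 1) :=
      Real.Gamma_add_one (by positivity)
    have h2 : 0 < Real.Gamma ((m : ℝ) + ν + 1) := Real.Gamma_pos_of_pos (by positivity)
    have h3 : ((m + 1 : ℕ) : ℝ) + ν + 1 = m + ν + 1 + 1 := by push_cast; ring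
    rw [h3, h1]
    nlinarith

theorem continuous_besselJ {ν : ℝ} (hν : 0 ≤ ν) : Continuous (besselJ ν) := by
  rw [← continuousOn_univ]
  have key : ∀ R : ℝ, 0 < R → ContinuousOn (besselJ ν) (Icc (-R) R) := by
    intro R hR
    have hG : 0 < Real.Gamma (ν + 1) := Real.Gamma_pos_of_pos (by positivity)
    refine continuousOn_tsum (u := fun m : ℕ =>
      ((R / 2) ^ 2) ^ m / (m.factorial : ℝ) * ((R / 2) ^ ν / Real.Gamma (ν + 1))) ?_ ?_ ?_
    · intro m
      unfold besselTerm
      refine Continuous.continuousOn ?_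
      refine continuous_const.mul ?_
      exact (Real.continuous_rpow_const (by positivity)).comp (continuous_id.div_const 2)
    · exact (Real.summable_pow_div_factorial _).mul_right _
    · intro m x hx
      have hx' : |x / 2| ≤ R / 2 := by
        rw [abs_div, abs_of_pos (by norm_num : (0 : ℝ) < 2)]
        have := abs_le.2 hx
        linarith
      have hG' := gamma_le_gamma_add hν m
      have hf : (0 : ℝ) < m.factorial := by exact_mod_cast m.factorial_pos
      have e1 : |(x / 2) ^ (2 * (m : ℝ) + ν)| ≤ ((R / 2) ^ 2) ^ m * (R / 2) ^ ν := by
        refine (Real.abs_rpow_le_abs_rpow _ _).trans ?_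
        refine (Real.rpow_le_rpow (abs_nonneg _) hx' (by positivity)).trans ?_
        rw [Real.rpow_add (by positivity), ← pow_mul]
        refine le_of_eq ?_
        congr 1
        rw [← Real.rpow_natCast]
        push_cast
        rfl
      unfold besselTerm
      rw [Real.norm_eq_abs, abs_mul, abs_div, abs_pow, abs_neg, abs_one, one_pow,
        abs_of_pos (mul_pos hf (hG.trans_le hG'))]
      calc 1 / ((m.factorial : ℝ) * Real.Gamma (m + ν + 1)) * |(x / 2) ^ (2 * (m : ℝ) + ν)|
          ≤ 1 / ((m.factorial : ℝ) * Real.Gamma (ν + 1)) *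
              (((R / 2) ^ 2) ^ m * (R / 2) ^ ν) := by gcongr
        _ = _ := by field_simp
  rw [continuousOn_univ, continuous_iff_continuousAt]
  intro x
  have hx : 0 < |x| + 1 := by positivity
  refine (key (|x| + 1) hx).continuousAt (Icc_mem_nhds ?_ ?_)
  · have := neg_abs_le x
    linarith
  · have := le_abs_self x
    linarith

theorem memLp_eigenfun {α β μ : ℝ} (hα2 : α < 2) (k : ℕ) :
    MemLp (eigenfun α β μ k) 2 (weightedMeasure β) := by
  have hκ : 0 < kappa α := by unfold kappa; linarith
  have hν : 0 ≤ nu α β μ := by unfold nu; positivity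
  have hJ := continuous_besselJ hν
  have hmeas : Measurable (eigenfun α β μ k) := by
    unfold eigenfun
    refine Measurable.mul (by fun_prop) ?_
    exact hJ.measurable.comp (by fun_prop)
  rw [memLp_two_iff_integrable_sq hmeas.aestronglyMeasurable]
  unfold weightedMeasure
  rw [integrable_withDensity_iff_integrable_smul' (by fun_prop) (by simp)]
  set c : ℝ := Real.sqrt (2 * kappa α) /
    |deriv (besselJ (nu α β μ)) (besselZero (nu α β μ) k)|
  set w : ℝ → ℝ := fun x => c ^ 2 *
    besselJ (nu α β μ) (besselZero (nu α β μ) k * x ^ kappa α) ^ 2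
  have hw : Continuous w := by
    have : Continuous fun x : ℝ => x ^ kappa α := Real.continuous_rpow_const hκ.le
    fun_prop
  have hI : IntegrableOn (fun x : ℝ => x ^ (1 - α)) (Icc 0 1) := by
    rw [integrableOn_Icc_iff_integrableOn_Ioc,
      ← intervalIntegrable_iff_integrableOn_Ioc_of_le zero_le_one]
    exact intervalIntegral.intervalIntegrable_rpow' (by linarith)
  have h2 : IntegrableOn (fun x : ℝ => w x * x ^ (1 - α)) (Ioo 0 1) :=
    (hI.continuousOn_mul hw.continuousOn isCompact_Icc).mono_set Ioo_subset_Icc_self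
  refine Integrable.congr h2 ?_
  filter_upwards [ae_restrict_mem measurableSet_Ioo] with x hx
  have hx0 : 0 < x := hx.1
  rw [ENNReal.toReal_ofReal (by positivity), smul_eq_mul]
  have e : x ^ (1 - α) = x ^ β * (x ^ ((1 - α - β) / 2)) ^ 2 := by
    rw [← Real.rpow_natCast, ← Real.rpow_mul hx0.le, ← Real.rpow_add hx0]
    congr 1
    push_cast
    ring
  simp only [w, e, eigenfun]
  ring

/-! ### The spaces `𝓗^s` and `𝓗^{-s}` -/

/-- `𝓗^s = { u = ∑ a_k Φ_k ∈ L²_β(0,1) : ∑ |a_k|² λ_k^{2s} < ∞ }`, `s ≥ 0`, where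
`a_k = ⟨u, Φ_k⟩_β`, as a linear subspace of `L²_β(0,1)`. -/
def hSubmodule (α β μ s : ℝ) : Submodule ℝ (L2w β) where
  carrier := {u | HasSum (fun k => inner ℝ (eigenvec α β μ k) u • eigenvec α β μ k) u ∧
    Summable (fun k => |inner ℝ (eigenvec α β μ k) u| ^ 2 * eigenvalue α β μ k ^ (2 * s))}
  zero_mem' := by simp [hasSum_zero, summable_zero]
  add_mem' := by
    rintro u v ⟨hu, hu'⟩ ⟨hv, hv'⟩
    refine ⟨by simpa [inner_add_right, add_smul] using hu.add hv, ?_⟩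
    refine Summable.of_nonneg_of_le (fun k => ?_) (fun k => ?_)
      ((hu'.add hv').mul_left 2)
    · have : 0 ≤ eigenvalue α β μ k := by unfold eigenvalue; positivity
      positivity
    · have h : 0 ≤ eigenvalue α β μ k := by unfold eigenvalue; positivity
      have h' : 0 ≤ eigenvalue α β μ k ^ (2 * s) := by positivity
      rw [inner_add_right, ← add_mul, ← mul_assoc]
      refine mul_le_mul_of_nonneg_right ?_ h'
      simp only [sq_abs]
      nlinarith [sq_nonneg (inner ℝ (eigenvec α β μ k) u - inner ℝ (eigenvec α β μ k) v)]
  smul_mem' := by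
    rintro c u ⟨hu, hu'⟩
    refine ⟨by simpa [inner_smul_right, mul_smul] using hu.const_smul c, ?_⟩
    refine (hu'.mul_left (c ^ 2)).congr (fun k => ?_)
    rw [inner_smul_right, sq_abs, sq_abs]
    ring

/-- The space `𝓗^s`, `s ≥ 0`, carrying its own norm (see `HSpace.norm_sq`), not the one of
`L²_β(0,1)`. It is only registered as a seminorm, since definiteness requires `λ_k > 0`. -/
def HSpace (α β μ s : ℝ) : Type := ↥(hSubmodule α β μ s)

namespace HSpace

variable {α β μ s : ℝ}

instance : AddCommGroup (HSpace α β μ s) := inferInstanceAs (AddCommGroup ↥(hSubmodule α β μ s))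

instance : Module ℝ (HSpace α β μ s) := inferInstanceAs (Module ℝ ↥(hSubmodule α β μ s))

/-- The inclusion `𝓗^s ⊂ L²_β(0,1)`. -/
def toL2 : HSpace α β μ s →ₗ[ℝ] L2w β := (hSubmodule α β μ s).subtype

theorem hasSum_toL2 (u : HSpace α β μ s) :
    HasSum (fun k => inner ℝ (eigenvec α β μ k) (toL2 u) • eigenvec α β μ k) (toL2 u) :=
  u.2.1

theorem summable_toL2 (u : HSpace α β μ s) :
    Summable (fun k =>
      |inner ℝ (eigenvec α β μ k) (toL2 u)| ^ 2 * eigenvalue α β μ k ^ (2 * s)) :=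
  u.2.2

theorem sq_weight (u : HSpace α β μ s) (k : ℕ) :
    (eigenvalue α β μ k ^ s * inner ℝ (eigenvec α β μ k) (toL2 u)) ^ 2 =
      |inner ℝ (eigenvec α β μ k) (toL2 u)| ^ 2 * eigenvalue α β μ k ^ (2 * s) := by
  have h : 0 ≤ eigenvalue α β μ k := by unfold eigenvalue; positivity
  rw [mul_pow, sq_abs, mul_comm 2 s, Real.rpow_mul h, Real.rpow_two]
  ring

/-- `u ↦ (λ_k^s ⟨u, Φ_k⟩_β)_k`, a linear map from `𝓗^s` to `ℓ²`. -/
def toSeq : HSpace α β μ s →ₗ[ℝ] lp (fun _ : ℕ => ℝ) 2 where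
  toFun u := ⟨fun k => eigenvalue α β μ k ^ s * inner ℝ (eigenvec α β μ k) (toL2 u), by
    refine memℓp_gen ?_
    refine (summable_toL2 u).congr (fun k => ?_)
    rw [← sq_weight u k, ENNReal.toReal_ofNat, Real.rpow_two, Real.norm_eq_abs, sq_abs]⟩
  map_add' u v := by
    ext k
    change eigenvalue α β μ k ^ s * inner ℝ (eigenvec α β μ k) (toL2 (u + v)) =
      eigenvalue α β μ k ^ s * inner ℝ (eigenvec α β μ k) (toL2 u) +
        eigenvalue α β μ k ^ s * inner ℝ (eigenvec α β μ k) (toL2 v)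
    rw [map_add, inner_add_right, mul_add]
  map_smul' c u := by
    ext k
    change eigenvalue α β μ k ^ s * inner ℝ (eigenvec α β μ k) (toL2 (c • u)) =
      c * (eigenvalue α β μ k ^ s * inner ℝ (eigenvec α β μ k) (toL2 u))
    rw [map_smul, inner_smul_right]
    ring

instance : SeminormedAddCommGroup (HSpace α β μ s) :=
  SeminormedAddCommGroup.induced (HSpace α β μ s) (lp (fun _ : ℕ => ℝ) 2) toSeq

instance : NormedSpace ℝ (HSpace α β μ s) :=
  NormedSpace.induced ℝ (HSpace α β μ s) (lp (fun _ : ℕ => ℝ) 2) toSeq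

/-- `‖u‖²_{𝓗^s} = ∑ |a_k|² λ_k^{2s}`, `a_k = ⟨u, Φ_k⟩_β`. -/
theorem norm_sq (u : HSpace α β μ s) :
    ‖u‖ ^ 2 = ∑' k, |inner ℝ (eigenvec α β μ k) (toL2 u)| ^ 2 * eigenvalue α β μ k ^ (2 * s) := by
  have h := lp.norm_rpow_eq_tsum (p := 2) (by simp) (toSeq u)
  have h2 : ‖toSeq u‖ ^ 2 = ∑' k, ‖toSeq u k‖ ^ 2 := by simpa using h
  change ‖toSeq u‖ ^ 2 = _
  rw [h2]
  refine tsum_congr (fun k => ?_)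
  rw [← sq_weight u k, Real.norm_eq_abs, sq_abs]
  rfl

end HSpace

/-- `𝓗^{-s}`, the dual space of `𝓗^s` with the dual norm. The pairing
`⟨w, z⟩_{𝓗^{-s}, 𝓗^s}` is the value `w z`. -/
abbrev HDual (α β μ s : ℝ) : Type := StrongDual ℝ (HSpace α β μ s)

/-! ### The semigroup -/

/-- `v = S(t) z` for `z = ∑ a_k Φ_k ∈ 𝓗^s`: `v = ∑ e^{-λ_k² t} a_k Φ_k`. -/
def IsSemigroup (α β μ s t : ℝ) (z : HSpace α β μ s) (v : L2w β) : Prop :=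
  HasSum (fun k => (Real.exp (-(eigenvalue α β μ k ^ 2) * t) *
    inner ℝ (eigenvec α β μ k) z.toL2) • eigenvec α β μ k) v

/-- `w = ∑ a_k Φ_k` in `𝓗^{-s}`, where `Φ_k` acts on `𝓗^s` through the pivot space `L²_β(0,1)`
and the series converges in the duality with `𝓗^s`. -/
def HasDualExpansion (α β μ s : ℝ) (a : ℕ → ℝ) (w : HDual α β μ s) : Prop :=
  ∀ z : HSpace α β μ s, HasSum (fun k => a k * inner ℝ (eigenvec α β μ k) z.toL2) (w z)

/-- `w = S(t) u₀` for `u₀ = ∑ a_k Φ_k ∈ 𝓗^{-s}`: `w = ∑ e^{-λ_k² t} a_k Φ_k` in `𝓗^{-s}`. -/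
def IsDualSemigroup (α β μ s t : ℝ) (u₀ w : HDual α β μ s) : Prop :=
  ∃ a : ℕ → ℝ, HasDualExpansion α β μ s a u₀ ∧
    HasDualExpansion α β μ s (fun k => Real.exp (-(eigenvalue α β μ k ^ 2) * t) * a k) w

/-! ### The operator `𝓐` and the boundary functional -/

/-- The differential expression
`𝓐 u = -(x^α u_x)_x - β x^{α-1} u_x - μ / x^{2-α} u` on `(0,1)`. -/
def opA (α β μ : ℝ) (u : ℝ → ℝ) (x : ℝ) : ℝ :=
  -deriv (fun y => y ^ α * deriv u y) x - β * x ^ (α - 1) * deriv u x - μ / x ^ (2 - α) * u x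

/-- The generalized limit `𝓞_δ(z) = lim_{x → 0⁺} x^δ z(x)` exists and is equal to `c`. -/
def HasGenLimit (δ : ℝ) (z : ℝ → ℝ) (c : ℝ) : Prop :=
  Tendsto (fun x => x ^ δ * z x) (𝓝[>] 0) (𝓝 c)

/-- `𝓞_{α+β+γ-ℓ}(∂_x^{1-ℓ} [𝓐^{1-r} v]) = c`, for `v ∈ L²_β(0,1)` having a representative which is
smooth on `(0,1)` (this representative is unique on `(0,1)`). -/
def HasBoundaryValue (α β μ : ℝ) (r : ℕ) (v : L2w β) (c : ℝ) : Prop :=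
  ∃ g : ℝ → ℝ, ContDiffOn ℝ (⊤ : ℕ∞) g (Ioo 0 1) ∧ v =ᵐ[weightedMeasure β] g ∧
    HasGenLimit (α + β + gam α β μ - ell α β)
      (deriv^[1 - ell α β] ((opA α β μ)^[1 - r] g)) c

/-! ### Weak solutions -/

/-- The space of controls `L²(0,T)`. -/
abbrev Control (T : ℝ) : Type := Lp ℝ 2 (volume.restrict (Ioo (0 : ℝ) T))

/-- The integral
`∫_0^τ f(t) 𝓞_{α+β+γ-ℓ}(∂_x^{1-ℓ} [𝓐^{1-r} S(τ-t) z]) dt`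
is well defined (the boundary values exist for all `t ∈ (0,τ)` and the integrand is integrable)
and equal to `I`. -/
def HasBoundaryIntegral (α β μ s : ℝ) (r : ℕ) {T : ℝ} (τ : ℝ) (f : Control T)
    (z : HSpace α β μ s) (I : ℝ) : Prop :=
  ∃ b : ℝ → ℝ,
    (∀ t ∈ Ioo 0 τ, ∃ v : L2w β, IsSemigroup α β μ s (τ - t) z v ∧
      HasBoundaryValue α β μ r v (b t)) ∧
    IntervalIntegrable (fun t => f t * b t) volume 0 τ ∧
    I = ∫ t in (0 : ℝ)..τ, f t * b t

/-- The formula defining weak solutions, at the time `τ`, for the value `w ∈ 𝓗^{-s}`: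
`⟨w, z⟩ = ⟨u₀, S(τ) z⟩ + (-1)^{1-ℓ} ∫_0^τ f(t) 𝓞_{α+β+γ-ℓ}(∂_x^{1-ℓ} [𝓐^{1-r} S(τ-t) z]) dt`
for all `z ∈ 𝓗^s`. -/
def WeakFormula (α β μ s : ℝ) (r : ℕ) {T : ℝ} (u₀ : HDual α β μ s) (f : Control T) (τ : ℝ)
    (w : HDual α β μ s) : Prop :=
  ∀ z : HSpace α β μ s, ∃ (z' : HSpace α β μ s) (I : ℝ),
    IsSemigroup α β μ s τ z z'.toL2 ∧ HasBoundaryIntegral α β μ s r τ f z I ∧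
    w z = u₀ z' + (-1) ^ (1 - ell α β) * I

/-- `u` is a weak solution on `[0,T]` with initial datum `u₀` and control `f`. -/
def IsWeakSolution (α β μ s : ℝ) (r : ℕ) {T : ℝ} (u₀ : HDual α β μ s) (f : Control T)
    (u : ℝ → HDual α β μ s) : Prop :=
  ContinuousOn u (Icc 0 T) ∧ ∀ τ ∈ Ioc 0 T, WeakFormula α β μ s r u₀ f τ (u τ)

end

end DegenerateFourthOrder

/-!
The functions `Φ_k` form an orthonormal family and, by definition, `𝓗^s` consists of the sums
`∑ a_k Φ_k` with `(λ_k^s a_k)_k ∈ ℓ²`. So `𝓗^s` is isometric to `ℓ²` (`seqEquiv`), `𝓗^{-s}` is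
represented by `ℓ²` as well (`dualOfSeq`, `exists_eq_dualOfSeq`), and `S(τ)` becomes multiplication
by `e^{-λ_k² τ}` (`decaySeq`). If `b_k` denotes the boundary value of `𝓐^{1-r} Φ_k`
(`controlCoeff`), then formally the boundary value of `𝓐^{1-r} S(t) z` is `∑ b_k e^{-λ_k² t} a_k`, so
that `B(τ) f` has the coefficients `b_k ∫₀^τ f(t) e^{-λ_k² (τ-t)} dt` (`controlSeq`). By the
Cauchy-Schwarz inequality these are at most `|b_k| ‖f‖ / λ_k`. Hence everything follows from
`∑ b_k² λ_k^{-2s-2} < ∞` (`summable_controlCoeff`), together with dominated convergence in `ℓ²` for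
the continuity in `τ`. Uniqueness holds because the defining formula prescribes `⟨u(τ), z⟩` for all
`z`, the boundary values being independent of the representative (`HasBoundaryValue.unique`).

The facts on Bessel functions come from the entire function `h_ν` with
`J_ν(x) = (x/2)^ν h_ν(x²/4)`, which satisfies `h_ν' = -h_{ν+1}` and
`h_ν(z) = (ν+1) h_{ν+1}(z) - z h_{ν+2}(z)`. Explicit primitives of `t^ν h_ν(At) h_ν(Bt)` give the
orthonormality (`orthonormal_eigenvec`). Up to a constant factor, `w(x) = √x J_ν(x)` is
`x^{ν+1/2} h_ν(x²/4)`, and it solves `w'' + (1 - (ν²-1/4)/x²) w = 0`. Its energy `w² + w'²` is bounded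
above and below away from `0`. This bounds `j J_ν'(j)²` from below at the zeros `j`, and shows that
the zeros are uniformly separated (`exists_zero_gap`), while a comparison with `sin (x/2)` shows that
there are infinitely many (`exists_zero_gt`). So `λ_k ≥ c (k+1)²` and `b_k² ≤ C λ_k^{ν+1/2+2(1-r)}`,
and `s > (ν+1)/2 - r` is what makes the series above converge.

That the boundary values exist and may be computed termwise rests on the fact that `S(t) z` is
represented by `x^p F(x^{2κ})` with `F(y) = ∑ d_k h_ν(z_k y)`, where `z_k = j_{ν,k+1}²/4`. For `t > 0`
the factor `e^{-λ_k² t}` beats the growth `|h_ν(z)| ≤ e^{|z|} / Γ(ν+1)`, so `F` is smooth on the whole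
line, including `0` (`contDiff_besselSeries`). On such functions `𝓐` acts as a regular operator in
`y = x^{2κ}` (`opA_profile`), and the boundary functional is evaluation of `F` at `0`
(`hasGenLimit_profile`).
-/

namespace DegenerateFourthOrder

noncomputable section

/-! ### The entire function underlying `J_ν` -/

/-- The entire function `h_ν(z) = ∑ (-z)^m / (m! Γ(m+ν+1))`, so that
`J_ν(x) = (x/2)^ν h_ν(x²/4)` for `x > 0`. -/
def besselEntire (ν z : ℝ) : ℝ := ∑' m : ℕ, (-z) ^ m / ((m.factorial : ℝ) * Real.Gamma (m + ν + 1))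

theorem abs_besselEntire_term_le {ν : ℝ} (hν : 0 ≤ ν) (z : ℝ) (m : ℕ) :
    |(-z) ^ m / ((m.factorial : ℝ) * Real.Gamma (m + ν + 1))| ≤
      |z| ^ m / m.factorial * (Real.Gamma (ν + 1))⁻¹ := by
  have hG : 0 < Real.Gamma (ν + 1) := Real.Gamma_pos_of_pos (by positivity)
  have hG' := gamma_le_gamma_add hν m
  have hf : (0 : ℝ) < m.factorial := by exact_mod_cast m.factorial_pos
  rw [abs_div, abs_pow, abs_neg, abs_of_pos (mul_pos hf (hG.trans_le hG')), ← div_eq_mul_inv,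
    div_div]
  gcongr

theorem summable_besselEntire {ν : ℝ} (hν : 0 ≤ ν) (z : ℝ) :
    Summable fun m : ℕ => (-z) ^ m / ((m.factorial : ℝ) * Real.Gamma (m + ν + 1)) :=
  Summable.of_norm_bounded ((Real.summable_pow_div_factorial _).mul_right _)
    fun m => (Real.norm_eq_abs _).le.trans (abs_besselEntire_term_le hν z m)

theorem abs_besselEntire_le {ν : ℝ} (hν : 0 ≤ ν) (z : ℝ) :
    |besselEntire ν z| ≤ Real.exp |z| * (Real.Gamma (ν + 1))⁻¹ := by
  have h := (NormedSpace.expSeries_div_hasSum_exp |z|).mul_right (Real.Gamma (ν + 1))⁻¹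
  rw [← Real.exp_eq_exp_ℝ] at h
  exact tsum_of_norm_bounded h fun m => (Real.norm_eq_abs _).le.trans <| abs_besselEntire_term_le hν z m

theorem besselEntire_zero (ν : ℝ) : besselEntire ν 0 = (Real.Gamma (ν + 1))⁻¹ := by
  unfold besselEntire
  rw [tsum_eq_single 0]
  · simp
  · intro m hm
    simp [hm]

theorem hasDerivAt_besselEntire {ν : ℝ} (hν : 0 ≤ ν) (z : ℝ) :
    HasDerivAt (besselEntire ν) (-besselEntire (ν + 1) z) z := by
  have hG : 0 < Real.Gamma (ν + 1) := Real.Gamma_pos_of_pos (by positivity)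
  set R := |z| + 1
  have hR : 0 < R := by positivity
  have hz : z ∈ Metric.ball (0 : ℝ) R := by simp [R]
  have hu : Summable fun m : ℕ => (m : ℝ) * R ^ (m - 1) / m.factorial * (Real.Gamma (ν + 1))⁻¹ := by
    refine Summable.mul_right _ ((summable_nat_add_iff 1).1 ?_)
    refine (Real.summable_pow_div_factorial R).congr fun m => ?_
    have hf : (m.factorial : ℝ) ≠ 0 := by exact_mod_cast m.factorial_ne_zero
    rw [Nat.factorial_succ]
    push_cast
    field_simp
  have key := hasDerivAt_tsum_of_isPreconnected (𝕜 := ℝ)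
    (g := fun (m : ℕ) (z : ℝ) => (-z) ^ m / ((m.factorial : ℝ) * Real.Gamma (m + ν + 1)))
    (g' := fun (m : ℕ) (z : ℝ) =>
      (m * (-z) ^ (m - 1) * (-1)) / ((m.factorial : ℝ) * Real.Gamma (m + ν + 1)))
    (t := Metric.ball (0 : ℝ) R) (y₀ := z) (y := z) hu
    Metric.isOpen_ball (convex_ball _ _).isPreconnected ?_ ?_ hz (summable_besselEntire hν z) hz
  · have hs : Summable fun m : ℕ =>
        (m * (-z) ^ (m - 1) * (-1)) / ((m.factorial : ℝ) * Real.Gamma (m + ν + 1)) := by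
      refine (summable_nat_add_iff 1).1 ?_
      refine (summable_besselEntire (by positivity : 0 ≤ ν + 1) z).neg.congr fun m => ?_
      have hf : (m.factorial : ℝ) ≠ 0 := by exact_mod_cast m.factorial_ne_zero
      rw [Nat.factorial_succ]
      push_cast
      rw [show (m : ℝ) + (ν + 1) + 1 = m + 1 + ν + 1 by ring]
      field_simp
    suffices h : -besselEntire (ν + 1) z = ∑' m : ℕ,
        (m * (-z) ^ (m - 1) * (-1)) / ((m.factorial : ℝ) * Real.Gamma (m + ν + 1)) by
      rw [h]
      exact key
    rw [hs.tsum_eq_zero_add]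
    simp only [Nat.cast_zero, zero_mul, zero_div, zero_add]
    unfold besselEntire
    rw [← tsum_neg]
    refine tsum_congr fun m => ?_
    have hf : (m.factorial : ℝ) ≠ 0 := by exact_mod_cast m.factorial_ne_zero
    rw [Nat.factorial_succ]
    push_cast
    rw [show (m : ℝ) + (ν + 1) + 1 = m + 1 + ν + 1 by ring]
    field_simp
  · intro m y _
    exact ((hasDerivAt_neg y).pow m).div_const _
  · intro m y hy
    have hy' : |y| ≤ R := by simpa using (mem_ball_zero_iff.1 hy).le
    have hG' := gamma_le_gamma_add hν m
    have hf : (0 : ℝ) < m.factorial := by exact_mod_cast m.factorial_pos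
    rw [Real.norm_eq_abs, abs_div, abs_mul, abs_mul, abs_pow, abs_neg, abs_neg, abs_one, mul_one,
      Nat.abs_cast, abs_of_pos (mul_pos hf (hG.trans_le hG')), ← div_eq_mul_inv, div_div]
    gcongr

/-- The three term recurrence of the Bessel functions. -/
theorem besselEntire_recurrence {ν : ℝ} (hν : 0 ≤ ν) (z : ℝ) :
    besselEntire ν z = (ν + 1) * besselEntire (ν + 1) z - z * besselEntire (ν + 2) z := by
  have h1 := summable_besselEntire (by positivity : 0 ≤ ν + 1) z
  have h2 := summable_besselEntire (by positivity : 0 ≤ ν + 2) z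
  have e2 : z * besselEntire (ν + 2) z = ∑' m : ℕ, -((m : ℝ) * ((-z) ^ m /
      ((m.factorial : ℝ) * Real.Gamma (m + (ν + 1) + 1)))) := by
    rw [Summable.tsum_eq_zero_add]
    · simp only [Nat.cast_zero, zero_mul, neg_zero, zero_add]
      unfold besselEntire
      rw [← tsum_mul_left]
      refine tsum_congr fun m => ?_
      have hf : (m.factorial : ℝ) ≠ 0 := by exact_mod_cast m.factorial_ne_zero
      rw [Nat.factorial_succ]
      push_cast
      rw [show (m : ℝ) + (ν + 2) + 1 = m + 1 + (ν + 1) + 1 by ring]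
      field_simp
      ring
    · refine (summable_nat_add_iff 1).1 ((h2.mul_left z).congr fun m => ?_)
      have hf : (m.factorial : ℝ) ≠ 0 := by exact_mod_cast m.factorial_ne_zero
      rw [Nat.factorial_succ]
      push_cast
      rw [show (m : ℝ) + (ν + 2) + 1 = m + 1 + (ν + 1) + 1 by ring]
      field_simp
      ring
  have h3 := ((summable_besselEntire hν z).sub (h1.mul_left (ν + 1)))
  have e (m : ℕ) : (-z) ^ m / ((m.factorial : ℝ) * Real.Gamma (m + ν + 1)) =
      (ν + 1) * ((-z) ^ m / ((m.factorial : ℝ) * Real.Gamma (m + (ν + 1) + 1))) -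
        -((m : ℝ) * ((-z) ^ m / ((m.factorial : ℝ) * Real.Gamma (m + (ν + 1) + 1)))) := by
    have hf : (m.factorial : ℝ) ≠ 0 := by exact_mod_cast m.factorial_ne_zero
    have hp : 0 < (m : ℝ) + ν + 1 := by positivity
    have hG : Real.Gamma (m + ν + 1) ≠ 0 := (Real.Gamma_pos_of_pos hp).ne'
    rw [show (m : ℝ) + (ν + 1) + 1 = (m + ν + 1) + 1 by ring, Real.Gamma_add_one hp.ne']
    field_simp
    ring
  have h4 : Summable fun m : ℕ => -((m : ℝ) * ((-z) ^ m /
      ((m.factorial : ℝ) * Real.Gamma (m + (ν + 1) + 1)))) := by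
    refine h3.neg.congr fun m => ?_
    rw [e m]
    ring
  rw [e2]
  unfold besselEntire
  rw [← tsum_mul_left, ← (h1.mul_left (ν + 1)).tsum_sub h4]
  exact tsum_congr e

theorem continuous_besselEntire {ν : ℝ} (hν : 0 ≤ ν) : Continuous (besselEntire ν) :=
  continuous_iff_continuousAt.2 fun z => (hasDerivAt_besselEntire hν z).continuousAt

theorem besselJ_eq_besselEntire (ν : ℝ) {x : ℝ} (hx : 0 < x) :
    besselJ ν x = (x / 2) ^ ν * besselEntire ν (x ^ 2 / 4) := by
  unfold besselJ besselEntire besselTerm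
  rw [← tsum_mul_left]
  refine tsum_congr fun m => ?_
  rw [Real.rpow_add (by positivity), Real.rpow_mul (by positivity), Real.rpow_natCast,
    show (x / 2) ^ (2 : ℝ) = x ^ 2 / 4 by rw [Real.rpow_two]; ring, neg_pow (x ^ 2 / 4)]
  ring

theorem besselJ_eq_zero_iff (ν : ℝ) {x : ℝ} (hx : 0 < x) :
    besselJ ν x = 0 ↔ besselEntire ν (x ^ 2 / 4) = 0 := by
  rw [besselJ_eq_besselEntire ν hx, mul_eq_zero, or_iff_right]
  positivity

theorem deriv_besselJ_of_zero {ν : ℝ} (hν : 0 ≤ ν) {x : ℝ} (hx : 0 < x)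
    (h0 : besselEntire ν (x ^ 2 / 4) = 0) :
    deriv (besselJ ν) x = -((x / 2) ^ (ν + 1) * besselEntire (ν + 1) (x ^ 2 / 4)) := by
  have h1 : HasDerivAt (fun y : ℝ => y ^ 2 / 4) (x / 2) x := by
    refine ((hasDerivAt_pow 2 x).div_const 4).congr_deriv ?_
    push_cast
    ring
  have h2 := (hasDerivAt_besselEntire hν (x ^ 2 / 4)).comp x h1
  have h3 : HasDerivAt (fun y : ℝ => (y / 2) ^ ν) (1 / 2 * ν * (x / 2) ^ (ν - 1)) x :=
    ((hasDerivAt_id x).div_const 2).rpow_const (Or.inl (by simp; positivity))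
  have h4 := h3.mul h2
  have h5 : besselJ ν =ᶠ[𝓝 x]
      ((fun y : ℝ => (y / 2) ^ ν) * (besselEntire ν ∘ fun y : ℝ => y ^ 2 / 4)) := by
    filter_upwards [lt_mem_nhds hx] with y hy
    exact besselJ_eq_besselEntire ν hy
  rw [(h4.congr_of_eventuallyEq h5).deriv]
  simp only [Function.comp_apply, h0]
  rw [Real.rpow_add_one (by positivity)]
  ring

/-! ### Oscillation of solutions of `w'' + q w = 0` with `q` close to `1` -/

section Oscillation

variable {w w' q : ℝ → ℝ} {K : ℝ}

/-- The energy `w² + w'²` stays between two positive constants, since its logarithmic derivative is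
bounded by the integrable function `K / x²`. -/
theorem energy_bounds (hw : ∀ x, 0 < x → HasDerivAt w (w' x) x)
    (hw' : ∀ x, 0 < x → HasDerivAt w' (-q x * w x) x)
    (hq : ∀ x, 0 < x → |q x - 1| ≤ K / x ^ 2) {x₀ : ℝ} (hx₀ : 0 < x₀) (h0 : w x₀ ≠ 0) :
    ∃ c C : ℝ, 0 < c ∧ ∀ x, x₀ ≤ x → c ≤ w x ^ 2 + w' x ^ 2 ∧ w x ^ 2 + w' x ^ 2 ≤ C := by
  have hK : 0 ≤ K := by simpa using (abs_nonneg _).trans (hq 1 one_pos)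
  have hE : ∀ x, 0 < x → HasDerivAt (fun x => w x ^ 2 + w' x ^ 2)
      (2 * (1 - q x) * (w x * w' x)) x := by
    intro x hx
    refine (((hw x hx).pow 2).add ((hw' x hx).pow 2)).congr_deriv ?_
    push_cast
    ring
  have hexp : ∀ σ x : ℝ, 0 < x →
      HasDerivAt (fun x => Real.exp (σ * x⁻¹)) (Real.exp (σ * x⁻¹) * (-σ / x ^ 2)) x := by
    intro σ x hx
    refine (((hasDerivAt_inv hx.ne').const_mul σ).exp).congr_deriv ?_
    field_simp
  have hb : ∀ x, 0 < x →
      |2 * (1 - q x) * (w x * w' x)| ≤ K / x ^ 2 * (w x ^ 2 + w' x ^ 2) := by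
    intro x hx
    have h1 : |2 * (w x * w' x)| ≤ w x ^ 2 + w' x ^ 2 := by
      rw [abs_le]
      constructor <;> nlinarith [sq_nonneg (w x - w' x), sq_nonneg (w x + w' x)]
    calc |2 * (1 - q x) * (w x * w' x)| = |q x - 1| * |2 * (w x * w' x)| := by
          rw [← abs_neg (q x - 1), ← abs_mul]
          congr 1
          ring
      _ ≤ K / x ^ 2 * (w x ^ 2 + w' x ^ 2) := by
          gcongr
          exact hq x hx
  have hD : ∀ σ x : ℝ, 0 < x → HasDerivAt (fun x => (w x ^ 2 + w' x ^ 2) * Real.exp (σ * x⁻¹))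
      ((2 * (1 - q x) * (w x * w' x) + (-σ / x ^ 2) * (w x ^ 2 + w' x ^ 2)) *
        Real.exp (σ * x⁻¹)) x := by
    intro σ x hx
    refine ((hE x hx).mul (hexp σ x hx)).congr_deriv ?_
    ring
  have hmono : MonotoneOn (fun x => (w x ^ 2 + w' x ^ 2) * Real.exp (-K * x⁻¹)) (Ioi 0) := by
    refine monotoneOn_of_deriv_nonneg (convex_Ioi 0)
      (fun x hx => (hD _ x hx).continuousAt.continuousWithinAt) ?_ ?_
    · rw [interior_Ioi]
      exact fun x hx => (hD _ x hx).differentiableAt.differentiableWithinAt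
    · rw [interior_Ioi]
      intro x hx
      rw [(hD _ x hx).deriv, neg_neg]
      have := (abs_le.1 (hb x hx)).1
      refine mul_nonneg (by linarith) (Real.exp_pos _).le
  have hanti : AntitoneOn (fun x => (w x ^ 2 + w' x ^ 2) * Real.exp (K * x⁻¹)) (Ioi 0) := by
    refine antitoneOn_of_deriv_nonpos (convex_Ioi 0)
      (fun x hx => (hD _ x hx).continuousAt.continuousWithinAt) ?_ ?_
    · rw [interior_Ioi]
      exact fun x hx => (hD _ x hx).differentiableAt.differentiableWithinAt
    · rw [interior_Ioi]
      intro x hx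
      rw [(hD _ x hx).deriv, neg_div]
      have := (abs_le.1 (hb x hx)).2
      refine mul_nonpos_of_nonpos_of_nonneg (by linarith) (Real.exp_pos _).le
  refine ⟨(w x₀ ^ 2 + w' x₀ ^ 2) * Real.exp (-K * x₀⁻¹),
    (w x₀ ^ 2 + w' x₀ ^ 2) * Real.exp (K * x₀⁻¹), by positivity, fun x hx => ⟨?_, ?_⟩⟩
  · have hx0 : 0 < x := hx₀.trans_le hx
    refine (hmono hx₀ hx0 hx).trans ?_
    refine mul_le_of_le_one_right (by positivity) (Real.exp_le_one_iff.2 ?_)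
    have : 0 ≤ K * x⁻¹ := by positivity
    linarith
  · have hx0 : 0 < x := hx₀.trans_le hx
    refine le_trans ?_ (hanti hx₀ hx0 hx)
    exact le_mul_of_one_le_right (by positivity) (Real.one_le_exp (by positivity))

/-- The zeros are uniformly separated: between two of them `w'` vanishes, and `w'` needs some time
to get from the size prescribed by the energy down to zero. -/
theorem exists_zero_gap (hw : ∀ x, 0 < x → HasDerivAt w (w' x) x)
    (hw' : ∀ x, 0 < x → HasDerivAt w' (-q x * w x) x)
    (hq : ∀ x, 0 < x → |q x - 1| ≤ K / x ^ 2) {x₀ : ℝ} (hx₀ : 0 < x₀) (h0 : w x₀ ≠ 0) :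
    ∃ δ, 0 < δ ∧ ∀ a b, x₀ ≤ a → a < b → w a = 0 → w b = 0 → δ ≤ b - a := by
  have hK : 0 ≤ K := by simpa using (abs_nonneg _).trans (hq 1 one_pos)
  obtain ⟨c, C, hc, hcC⟩ := energy_bounds hw hw' hq hx₀ h0
  have hC : 0 < C := hc.trans_le ((hcC x₀ le_rfl).1.trans (hcC x₀ le_rfl).2)
  set M := 1 + K / x₀ ^ 2
  have hM : 0 < M := by positivity
  refine ⟨Real.sqrt (c / (M ^ 2 * C)), by positivity, fun a b ha hab hwa hwb => ?_⟩
  have ha0 : 0 < a := hx₀.trans_le ha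
  obtain ⟨ξ, hξ, hξ0⟩ := exists_hasDerivAt_eq_zero hab
    (fun x hx => (hw x (ha0.trans_le hx.1)).continuousAt.continuousWithinAt) (hwa.trans hwb.symm)
    (fun x hx => hw x (ha0.trans hx.1))
  obtain ⟨η, hη, hη0⟩ := exists_hasDerivAt_eq_slope w' _ hξ.1
    (fun x hx => (hw' x (ha0.trans_le hx.1)).continuousAt.continuousWithinAt)
    (fun x hx => hw' x (ha0.trans hx.1))
  have hξa : 0 < ξ - a := sub_pos.2 hξ.1
  rw [hξ0, eq_div_iff hξa.ne'] at hη0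
  have h1 := (hcC a ha).1
  have hη1 : x₀ ≤ η := ha.trans hη.1.le
  have h2 : w η ^ 2 ≤ C := by nlinarith [(hcC η hη1).2, sq_nonneg (w' η)]
  have h3 : q η ^ 2 ≤ M ^ 2 := by
    have h4 : |q η| ≤ M := by
      have h5 : |q η| ≤ |q η - 1| + 1 := by
        simpa using abs_add_le (q η - 1) 1
      have h6 : K / η ^ 2 ≤ K / x₀ ^ 2 := by gcongr
      have := hq η (hx₀.trans_le hη1)
      linarith
    rw [← sq_abs (q η)]
    gcongr
  refine Real.sqrt_le_iff.2 ⟨by linarith, ?_⟩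
  rw [div_le_iff₀ (by positivity)]
  calc c ≤ w' a ^ 2 := by simpa [hwa] using h1
    _ = (ξ - a) ^ 2 * (q η ^ 2 * w η ^ 2) := by
      rw [show w' a = q η * w η * (ξ - a) by linarith]
      ring
    _ ≤ (b - a) ^ 2 * (M ^ 2 * C) := by
      have := hξ.2.le
      gcongr

/-- A solution cannot stay positive on an interval of length `2π` on which `q ≥ 1/4`. -/
theorem false_of_pos_of_oscillation (hw : ∀ x, 0 < x → HasDerivAt w (w' x) x)
    (hw' : ∀ x, 0 < x → HasDerivAt w' (-q x * w x) x) {X : ℝ} (hX : 0 < X)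
    (hq : ∀ x, X ≤ x → 1 / 4 ≤ q x) (hpos : ∀ x ∈ Icc X (X + 2 * Real.pi), 0 < w x) : False := by
  have hs : ∀ x, HasDerivAt (fun x => (x - X) / 2) (1 / 2) x := fun x =>
    ((hasDerivAt_id x).sub_const X).div_const 2
  -- the Wronskian of `w` and of a solution of `v'' + v / 4 = 0`
  have hφ : ∀ x, 0 < x → HasDerivAt
      (fun x => w' x * Real.sin ((x - X) / 2) - w x * Real.cos ((x - X) / 2) / 2)
      (-((q x - 1 / 4) * w x * Real.sin ((x - X) / 2))) x := by
    intro x hx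
    refine (((hw' x hx).mul (hs x).sin).sub (((hw x hx).mul (hs x).cos).div_const 2)).congr_deriv ?_
    ring
  have hpi := Real.pi_pos
  have hanti : AntitoneOn
      (fun x => w' x * Real.sin ((x - X) / 2) - w x * Real.cos ((x - X) / 2) / 2)
      (Icc X (X + 2 * Real.pi)) := by
    refine antitoneOn_of_deriv_nonpos (convex_Icc _ _)
      (fun x hx => (hφ x (hX.trans_le hx.1)).continuousAt.continuousWithinAt) ?_ ?_
    · rw [interior_Icc]
      exact fun x hx => (hφ x (hX.trans hx.1)).differentiableAt.differentiableWithinAt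
    · rw [interior_Icc]
      intro x hx
      rw [(hφ x (hX.trans hx.1)).deriv]
      have h1 := hq x hx.1.le
      have h2 := hpos x (Ioo_subset_Icc_self hx)
      have h3 : 0 ≤ Real.sin ((x - X) / 2) :=
        Real.sin_nonneg_of_nonneg_of_le_pi (by linarith [hx.1]) (by linarith [hx.2])
      have h4 : 0 ≤ q x - 1 / 4 := by linarith
      have : 0 ≤ (q x - 1 / 4) * w x * Real.sin ((x - X) / 2) := by positivity
      linarith
  have h := hanti (left_mem_Icc.2 (by linarith)) (right_mem_Icc.2 (by linarith))
    (by linarith : X ≤ X + 2 * Real.pi)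
  have e : (X + 2 * Real.pi - X) / 2 = Real.pi := by ring
  simp only [e, sub_self, zero_div, Real.sin_pi, Real.cos_pi, Real.sin_zero, Real.cos_zero] at h
  have h1 := hpos X (left_mem_Icc.2 (by linarith))
  have h2 := hpos (X + 2 * Real.pi) (right_mem_Icc.2 (by linarith))
  linarith

theorem exists_zero_gt (hw : ∀ x, 0 < x → HasDerivAt w (w' x) x)
    (hw' : ∀ x, 0 < x → HasDerivAt w' (-q x * w x) x)
    (hq : ∀ x, 0 < x → |q x - 1| ≤ K / x ^ 2) (Y : ℝ) : ∃ x, Y < x ∧ w x = 0 := by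
  by_contra! hne
  have hK : 0 ≤ K := by simpa using (abs_nonneg _).trans (hq 1 one_pos)
  set X := |Y| + 1 + 2 * K
  have hX1 : 1 ≤ X := by
    have := abs_nonneg Y
    linarith
  have hX : 0 < X := by linarith
  have hYX : Y < X := by
    have := le_abs_self Y
    linarith
  have hq' : ∀ x, X ≤ x → 1 / 4 ≤ q x := by
    intro x hx
    have hx1 : 1 ≤ x := hX1.trans hx
    have h1 : K / x ^ 2 ≤ 1 / 2 := by
      rw [div_le_iff₀ (by positivity)]
      have : 2 * K ≤ x := by
        have := abs_nonneg Y
        linarith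
      nlinarith
    have := (abs_le.1 ((hq x (by linarith)).trans h1)).1
    linarith
  have hcont : ContinuousOn w (Ici X) := fun x hx =>
    (hw x (hX.trans_le hx)).continuousAt.continuousWithinAt
  have hne' : ∀ x ∈ Ici X, w x ≠ 0 := fun x hx => hne x (hYX.trans_le hx)
  rcases (hne' X self_mem_Ici).lt_or_gt with hneg | hpos
  · refine false_of_pos_of_oscillation (w := fun x => -w x) (w' := fun x => -w' x) (q := q)
      (fun x hx => (hw x hx).neg) (fun x hx => (hw' x hx).neg.congr_deriv (by ring)) hX hq' ?_
    intro x hx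
    by_contra! hx'
    obtain ⟨y, hy, hy0⟩ := isPreconnected_Ici.intermediate_value self_mem_Ici
      (show x ∈ Ici X from hx.1) hcont (show (0 : ℝ) ∈ Icc (w X) (w x) from ⟨hneg.le, by linarith⟩)
    exact hne' y hy hy0
  · refine false_of_pos_of_oscillation hw hw' hX hq' ?_
    intro x hx
    by_contra! hx'
    obtain ⟨y, hy, hy0⟩ := isPreconnected_Ici.intermediate_value (show x ∈ Ici X from hx.1)
      self_mem_Ici hcont (show (0 : ℝ) ∈ Icc (w x) (w X) from ⟨hx', hpos.le⟩)
    exact hne' y hy hy0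

end Oscillation

/-! ### The positive zeros of `J_ν` -/

/-- Up to a constant factor, `√x J_ν(x)`. -/
def besselNormal (ν x : ℝ) : ℝ := x ^ (ν + 1 / 2) * besselEntire ν (x ^ 2 / 4)

/-- The derivative of `besselNormal ν`. -/
def besselNormalDeriv (ν x : ℝ) : ℝ :=
  x ^ (ν + 1 / 2) * ((ν + 1 / 2) / x * besselEntire ν (x ^ 2 / 4) -
    x / 2 * besselEntire (ν + 1) (x ^ 2 / 4))

theorem hasDerivAt_besselEntire_sq {ν : ℝ} (hν : 0 ≤ ν) (x : ℝ) :
    HasDerivAt (fun x => besselEntire ν (x ^ 2 / 4))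
      (-(x / 2 * besselEntire (ν + 1) (x ^ 2 / 4))) x := by
  have h1 : HasDerivAt (fun y : ℝ => y ^ 2 / 4) (x / 2) x := by
    refine ((hasDerivAt_pow 2 x).div_const 4).congr_deriv ?_
    push_cast
    ring
  refine ((hasDerivAt_besselEntire hν (x ^ 2 / 4)).comp x h1).congr_deriv ?_
  ring

theorem hasDerivAt_besselNormal {ν : ℝ} (hν : 0 ≤ ν) {x : ℝ} (hx : 0 < x) :
    HasDerivAt (besselNormal ν) (besselNormalDeriv ν x) x := by
  refine ((Real.hasDerivAt_rpow_const (p := ν + 1 / 2) (Or.inl hx.ne')).mul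
    (hasDerivAt_besselEntire_sq hν x)).congr_deriv ?_
  rw [Real.rpow_sub_one hx.ne']
  unfold besselNormalDeriv
  ring

theorem hasDerivAt_besselNormalDeriv {ν : ℝ} (hν : 0 ≤ ν) {x : ℝ} (hx : 0 < x) :
    HasDerivAt (besselNormalDeriv ν)
      (-(1 - (ν ^ 2 - 1 / 4) / x ^ 2) * besselNormal ν x) x := by
  have h1 : HasDerivAt (fun x : ℝ => (ν + 1 / 2) / x) (-(ν + 1 / 2) / x ^ 2) x := by
    refine ((hasDerivAt_inv hx.ne').const_mul (ν + 1 / 2)).congr_deriv ?_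
    ring
  have h2 : HasDerivAt (fun x : ℝ => x / 2) (1 / 2) x := (hasDerivAt_id x).div_const 2
  refine ((Real.hasDerivAt_rpow_const (p := ν + 1 / 2) (Or.inl hx.ne')).mul
    ((h1.mul (hasDerivAt_besselEntire_sq hν x)).sub
      (h2.mul (hasDerivAt_besselEntire_sq (by positivity : 0 ≤ ν + 1) x)))).congr_deriv ?_
  have hrec := besselEntire_recurrence hν (x ^ 2 / 4)
  rw [Real.rpow_sub_one hx.ne', show ν + 1 + 1 = ν + 2 by ring]
  unfold besselNormal
  have e : besselEntire (ν + 2) (x ^ 2 / 4) = 4 / x ^ 2 *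
      ((ν + 1) * besselEntire (ν + 1) (x ^ 2 / 4) - besselEntire ν (x ^ 2 / 4)) := by
    rw [hrec]
    field_simp
    ring
  simp only [Pi.mul_apply, Pi.sub_apply]
  rw [e]
  field_simp
  ring

theorem abs_besselPotential_sub_one (ν x : ℝ) :
    |1 - (ν ^ 2 - 1 / 4) / x ^ 2 - 1| ≤ |ν ^ 2 - 1 / 4| / x ^ 2 := by
  rw [sub_sub_cancel_left, abs_neg, abs_div, abs_of_nonneg (sq_nonneg x)]

theorem besselJ_eq_zero_iff_besselNormal (ν : ℝ) {x : ℝ} (hx : 0 < x) :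
    besselJ ν x = 0 ↔ besselNormal ν x = 0 := by
  rw [besselJ_eq_zero_iff ν hx, besselNormal, mul_eq_zero, or_iff_right]
  positivity

theorem exists_besselNormal_pos {ν : ℝ} (hν : 0 ≤ ν) :
    ∃ x₀, 0 < x₀ ∧ ∀ x, 0 < x → x ≤ x₀ → 0 < besselNormal ν x := by
  have hc : ContinuousAt (fun x : ℝ => besselEntire ν (x ^ 2 / 4)) 0 :=
    (hasDerivAt_besselEntire_sq hν 0).continuousAt
  have h0 : 0 < besselEntire ν ((0 : ℝ) ^ 2 / 4) := by
    have : 0 < Real.Gamma (ν + 1) := Real.Gamma_pos_of_pos (by positivity)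
    simpa [besselEntire_zero] using this
  obtain ⟨ε, hε, h⟩ := Metric.eventually_nhds_iff.1 (hc.eventually (lt_mem_nhds h0))
  refine ⟨ε / 2, by positivity, fun x hx hxε => mul_pos (by positivity) (h ?_)⟩
  rw [Real.dist_eq, sub_zero, abs_of_pos hx]
  linarith

/-- The infima defining `besselZero` are attained: `besselZero ν` enumerates zeros of `J_ν`, is
strictly increasing, and grows at least linearly. -/
theorem besselZero_spec {ν : ℝ} (hν : 0 ≤ ν) : ∃ c, 0 < c ∧ ∀ k : ℕ,
    besselJ ν (besselZero ν k) = 0 ∧ c * (k + 1) ≤ besselZero ν k ∧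
      besselZero ν k < besselZero ν (k + 1) := by
  obtain ⟨x₀, hx₀, hpos⟩ := exists_besselNormal_pos hν
  obtain ⟨δ, hδ, hgap⟩ := exists_zero_gap (fun x hx => hasDerivAt_besselNormal hν hx)
    (fun x hx => hasDerivAt_besselNormalDeriv hν hx) (fun x _ => abs_besselPotential_sub_one ν x)
    hx₀ (hpos x₀ hx₀ le_rfl).ne'
  have hx₀' : ∀ x, 0 < x → besselJ ν x = 0 → x₀ < x := by
    intro x hx hJ
    by_contra! h
    exact (hpos x hx h).ne' ((besselJ_eq_zero_iff_besselNormal ν hx).1 hJ)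
  -- since zeros are separated by `δ`, the infimum over the zeros beyond `y` is attained
  have hmem : ∀ y, 0 ≤ y → sInf {x : ℝ | y < x ∧ besselJ ν x = 0} ∈
      {x : ℝ | y < x ∧ besselJ ν x = 0} := by
    intro y hy
    set S := {x : ℝ | y < x ∧ besselJ ν x = 0}
    have hne : S.Nonempty := by
      obtain ⟨x, hx, hx0⟩ := exists_zero_gt (fun x hx => hasDerivAt_besselNormal hν hx)
        (fun x hx => hasDerivAt_besselNormalDeriv hν hx)
        (fun x _ => abs_besselPotential_sub_one ν x) y
      exact ⟨x, hx, (besselJ_eq_zero_iff_besselNormal ν (hy.trans_lt hx)).2 hx0⟩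
    have hbdd : BddBelow S := ⟨y, fun x hx => hx.1.le⟩
    obtain ⟨x, hxS, hx⟩ := exists_lt_of_csInf_lt hne (lt_add_of_pos_right (sInf S) hδ)
    have hle : sInf S ≤ x := csInf_le hbdd hxS
    rcases hle.eq_or_lt with h | h
    · rwa [h]
    · exfalso
      obtain ⟨x', hxS', hx'⟩ := exists_lt_of_csInf_lt hne h
      have h1 := csInf_le hbdd hxS'
      have hx0 : 0 < x := hy.trans_lt hxS.1
      have hx0' : 0 < x' := hy.trans_lt hxS'.1
      have := hgap x' x (hx₀' x' hx0' hxS'.2).le hx'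
        ((besselJ_eq_zero_iff_besselNormal ν hx0').1 hxS'.2)
        ((besselJ_eq_zero_iff_besselNormal ν hx0).1 hxS.2)
      linarith
  have hpos' : ∀ k, 0 < besselZero ν k ∧ besselJ ν (besselZero ν k) = 0 := by
    intro k
    induction k with
    | zero => exact hmem 0 le_rfl
    | succ k ih =>
      have := hmem _ ih.1.le
      exact ⟨ih.1.trans this.1, this.2⟩
  have hlt : ∀ k, besselZero ν k < besselZero ν (k + 1) := fun k => (hmem _ (hpos' k).1.le).1
  have hge : ∀ k : ℕ, min x₀ δ * (k + 1) ≤ besselZero ν k := by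
    intro k
    induction k with
    | zero =>
      have h1 := hx₀' _ (hpos' 0).1 (hpos' 0).2
      have h2 := min_le_left x₀ δ
      simp only [Nat.cast_zero, zero_add, mul_one]
      exact h2.trans h1.le
    | succ k ih =>
      have h1 := hgap _ _ (hx₀' _ (hpos' k).1 (hpos' k).2).le (hlt k)
        ((besselJ_eq_zero_iff_besselNormal ν (hpos' k).1).1 (hpos' k).2)
        ((besselJ_eq_zero_iff_besselNormal ν (hpos' _).1).1 (hpos' _).2)
      have h2 := min_le_right x₀ δ
      push_cast
      linarith
  exact ⟨min x₀ δ, lt_min hx₀ hδ, fun k => ⟨(hpos' k).2, hge k, hlt k⟩⟩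

theorem besselZero_pos {ν : ℝ} (hν : 0 ≤ ν) (k : ℕ) : 0 < besselZero ν k := by
  obtain ⟨c, hc, h⟩ := besselZero_spec hν
  exact lt_of_lt_of_le (by positivity) (h k).2.1

theorem besselZero_strictMono {ν : ℝ} (hν : 0 ≤ ν) : StrictMono (besselZero ν) := by
  obtain ⟨c, hc, h⟩ := besselZero_spec hν
  exact strictMono_nat_of_lt_succ fun k => (h k).2.2

/-- The zeros `z_k = j_{ν,k+1}² / 4` of `h_ν`. -/
def entireZero (ν : ℝ) (k : ℕ) : ℝ := besselZero ν k ^ 2 / 4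

theorem entireZero_pos {ν : ℝ} (hν : 0 ≤ ν) (k : ℕ) : 0 < entireZero ν k := by
  have := besselZero_pos hν k
  unfold entireZero
  positivity

theorem entireZero_injective {ν : ℝ} (hν : 0 ≤ ν) : Function.Injective (entireZero ν) := by
  intro i k h
  unfold entireZero at h
  refine (besselZero_strictMono hν).injective ?_
  have hi := besselZero_pos hν i
  have hk := besselZero_pos hν k
  exact (pow_left_inj₀ hi.le hk.le two_ne_zero).1 (by linarith)

theorem besselEntire_entireZero {ν : ℝ} (hν : 0 ≤ ν) (k : ℕ) :
    besselEntire ν (entireZero ν k) = 0 := by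
  obtain ⟨c, hc, h⟩ := besselZero_spec hν
  exact (besselJ_eq_zero_iff ν (besselZero_pos hν k)).1 (h k).1

theorem exists_le_entireZero {ν : ℝ} (hν : 0 ≤ ν) :
    ∃ c, 0 < c ∧ ∀ k : ℕ, c * ((k : ℝ) + 1) ^ 2 ≤ entireZero ν k := by
  obtain ⟨c, hc, h⟩ := besselZero_spec hν
  refine ⟨c ^ 2 / 4, by positivity, fun k => ?_⟩
  unfold entireZero
  have h1 : (c * ((k : ℝ) + 1)) ^ 2 ≤ besselZero ν k ^ 2 := by
    gcongr
    exact (h k).2.1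
  linarith

/-- The lower bound `J_ν'(j) ≥ c j^{-1/2}` at the zeros `j`, in terms of `h_{ν+1} = -h_ν'`. -/
theorem exists_le_besselEntire_succ_entireZero {ν : ℝ} (hν : 0 ≤ ν) :
    ∃ c, 0 < c ∧ ∀ k : ℕ,
      c ≤ entireZero ν k ^ (ν + 3 / 2) * besselEntire (ν + 1) (entireZero ν k) ^ 2 := by
  obtain ⟨x₀, hx₀, hpos⟩ := exists_besselNormal_pos hν
  obtain ⟨c, C, hc, hcC⟩ := energy_bounds (fun x hx => hasDerivAt_besselNormal hν hx)
    (fun x hx => hasDerivAt_besselNormalDeriv hν hx) (fun x _ => abs_besselPotential_sub_one ν x)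
    hx₀ (hpos x₀ hx₀ le_rfl).ne'
  refine ⟨c / 4 ^ (ν + 1 / 2), by positivity, fun k => ?_⟩
  set j := besselZero ν k
  have hj : 0 < j := besselZero_pos hν k
  have hz : besselEntire ν (j ^ 2 / 4) = 0 := besselEntire_entireZero hν k
  have hw : besselNormal ν j = 0 := by simp [besselNormal, hz]
  have hx : x₀ ≤ j := by
    by_contra! h
    exact (hpos j hj h.le).ne' hw
  have h1 := (hcC j hx).1
  have hz0 := entireZero_pos hν k
  rw [hw, besselNormalDeriv, hz] at h1
  have e1 : (j ^ (ν + 1 / 2)) ^ 2 = (4 * entireZero ν k) ^ (ν + 1 / 2) := by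
    rw [show 4 * entireZero ν k = j ^ 2 by unfold entireZero; ring, ← Real.rpow_natCast,
      ← Real.rpow_natCast, ← Real.rpow_mul hj.le, ← Real.rpow_mul hj.le]
    congr 1
    ring
  have e2 : entireZero ν k ^ (ν + 3 / 2) = entireZero ν k ^ (ν + 1 / 2) * entireZero ν k := by
    rw [← Real.rpow_add_one hz0.ne']
    congr 1
    ring
  rw [div_le_iff₀ (by positivity), e2]
  refine h1.trans (le_of_eq ?_)
  rw [mul_zero, zero_sub, mul_pow, e1, Real.mul_rpow (by norm_num) hz0.le]
  have e3 : j ^ 2 / 4 = entireZero ν k := rfl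
  have e4 : (j / 2) ^ 2 = entireZero ν k := by rw [← e3]; ring
  rw [e3]
  linear_combination (4 ^ (ν + 1 / 2) * entireZero ν k ^ (ν + 1 / 2) *
    besselEntire (ν + 1) (entireZero ν k) ^ 2) * e4

/-! ### The eigenfunctions form an orthonormal family -/

theorem kappa_pos {α : ℝ} (hα2 : α < 2) : 0 < kappa α := by
  unfold kappa
  linarith

theorem nu_nonneg {α : ℝ} (hα2 : α < 2) (β μ : ℝ) : 0 ≤ nu α β μ := by
  have := kappa_pos hα2
  unfold nu
  positivity

/-- The exponent `p = (1-α-β)/2 + √(μ(α+β) - μ)` such that `Φ_k(x)` behaves like a multiple of `x^p`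
as `x → 0⁺`. -/
def eigenExp (α β μ : ℝ) : ℝ := (1 - α - β) / 2 + Real.sqrt (muCrit (α + β) - μ)

/-- The factor `C_k` in `Φ_k(x) = C_k x^p h_ν(z_k x^{2κ})`. -/
def eigenCoeff (α β μ : ℝ) (k : ℕ) : ℝ :=
  Real.sqrt (2 * kappa α) / |deriv (besselJ (nu α β μ)) (besselZero (nu α β μ) k)| *
    (besselZero (nu α β μ) k / 2) ^ nu α β μ

theorem eigenfun_eq {α : ℝ} (hα2 : α < 2) (β μ : ℝ) (k : ℕ) {x : ℝ} (hx : 0 < x) :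
    eigenfun α β μ k x = eigenCoeff α β μ k *
      (x ^ eigenExp α β μ *
        besselEntire (nu α β μ) (entireZero (nu α β μ) k * x ^ (2 * kappa α))) := by
  have hκ := kappa_pos hα2
  have hj := besselZero_pos (nu_nonneg hα2 β μ) k
  have e : kappa α * nu α β μ = Real.sqrt (muCrit (α + β) - μ) := by
    unfold nu
    field_simp
  unfold eigenfun eigenCoeff eigenExp entireZero
  rw [besselJ_eq_besselEntire _ (by positivity), mul_pow, ← Real.rpow_mul_natCast hx.le,
    mul_div_right_comm, Real.mul_rpow (by positivity) (by positivity), ← Real.rpow_mul hx.le, e,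
    Real.rpow_add hx]
  push_cast
  rw [mul_comm (kappa α) 2, mul_div_right_comm]
  ring

theorem besselEntire_succ_entireZero_ne_zero {ν : ℝ} (hν : 0 ≤ ν) (k : ℕ) :
    besselEntire (ν + 1) (entireZero ν k) ≠ 0 := by
  obtain ⟨c, hc, h⟩ := exists_le_besselEntire_succ_entireZero hν
  intro h0
  have := h k
  rw [h0] at this
  simp at this
  linarith

theorem eigenCoeff_sq {α : ℝ} (hα2 : α < 2) (β μ : ℝ) (k : ℕ) :
    eigenCoeff α β μ k ^ 2 * (entireZero (nu α β μ) k *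
      besselEntire (nu α β μ + 1) (entireZero (nu α β μ) k) ^ 2) = 2 * kappa α := by
  have hκ := kappa_pos hα2
  have hν := nu_nonneg hα2 β μ
  have hj := besselZero_pos hν k
  have h1 := besselEntire_succ_entireZero_ne_zero hν k
  unfold eigenCoeff
  rw [deriv_besselJ_of_zero hν hj (besselEntire_entireZero hν k)]
  change _ * (_ * besselEntire _ (besselZero (nu α β μ) k ^ 2 / 4) ^ 2) = _
  change besselEntire _ (besselZero (nu α β μ) k ^ 2 / 4) ≠ 0 at h1
  rw [abs_neg, abs_mul, Real.rpow_add_one (by positivity), abs_of_pos (by positivity),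
    mul_pow, div_pow, Real.sq_sqrt (by positivity), mul_pow, sq_abs]
  unfold entireZero
  field_simp
  norm_num

/-- `∫₀¹ x^{σ(ν+1)-1} g(x^σ) dx` by the substitution `t = x^σ`. -/
theorem integral_rpow_comp {σ ν : ℝ} (hσ : 0 < σ) (hν : 0 ≤ ν) {G g : ℝ → ℝ} (hG : Continuous G)
    (hg : Continuous g) (hGg : ∀ t, 0 < t → HasDerivAt G (t ^ ν * g t) t) :
    σ * ∫ x in (0 : ℝ)..1, x ^ (σ * (ν + 1) - 1) * g (x ^ σ) = G 1 - G 0 := by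
  have hc : Continuous fun x : ℝ => x ^ σ := Real.continuous_rpow_const hσ.le
  rw [← intervalIntegral.integral_const_mul]
  have key := intervalIntegral.integral_eq_sub_of_hasDerivAt_of_le (zero_le_one (α := ℝ))
    (f := fun x => G (x ^ σ)) (f' := fun x => σ * (x ^ (σ * (ν + 1) - 1) * g (x ^ σ)))
    (hG.comp hc).continuousOn ?_ ?_
  · rw [key]
    simp [Real.zero_rpow hσ.ne']
  · intro x hx
    have hx0 : 0 < x := hx.1
    refine ((hGg _ (Real.rpow_pos_of_pos hx0 σ)).comp x
      (Real.hasDerivAt_rpow_const (p := σ) (Or.inl hx0.ne'))).congr_deriv ?_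
    rw [← Real.rpow_mul hx0.le, show σ * (ν + 1) - 1 = σ * ν + (σ - 1) by ring,
      Real.rpow_add hx0]
    ring
  · refine IntervalIntegrable.const_mul ?_ σ
    refine IntervalIntegrable.mul_continuousOn ?_ (hg.comp hc).continuousOn
    refine intervalIntegral.intervalIntegrable_rpow' ?_
    have : 0 < σ * (ν + 1) := by positivity
    linarith

theorem hasDerivAt_besselEntire_mul {ν : ℝ} (hν : 0 ≤ ν) (A t : ℝ) :
    HasDerivAt (fun t => besselEntire ν (A * t)) (-(A * besselEntire (ν + 1) (A * t))) t := by
  refine ((hasDerivAt_besselEntire hν (A * t)).comp t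
    ((hasDerivAt_id t).const_mul A)).congr_deriv ?_
  ring

theorem continuous_besselEntire_mul {ν : ℝ} (hν : 0 ≤ ν) (A : ℝ) :
    Continuous fun t => besselEntire ν (A * t) :=
  (continuous_besselEntire hν).comp (continuous_const_mul A)

/-- The functions `x ↦ h_ν(z x^σ)` for different zeros `z` are orthogonal. -/
theorem integral_besselEntire_mul_eq_zero {σ ν : ℝ} (hσ : 0 < σ) (hν : 0 ≤ ν) {A B : ℝ}
    (hAB : A ≠ B) (hA : besselEntire ν A = 0) (hB : besselEntire ν B = 0) :
    ∫ x in (0 : ℝ)..1, x ^ (σ * (ν + 1) - 1) *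
      (besselEntire ν (A * x ^ σ) * besselEntire ν (B * x ^ σ)) = 0 := by
  have hν1 : 0 ≤ ν + 1 := by positivity
  have cA := continuous_besselEntire_mul hν A
  have cB := continuous_besselEntire_mul hν B
  have cA1 := continuous_besselEntire_mul hν1 A
  have cB1 := continuous_besselEntire_mul hν1 B
  have cp : Continuous fun t : ℝ => t ^ (ν + 1) := Real.continuous_rpow_const hν1
  have key := integral_rpow_comp hσ hν
    (G := fun t => t ^ (ν + 1) * (B * (besselEntire ν (A * t) * besselEntire (ν + 1) (B * t)) -
      A * (besselEntire (ν + 1) (A * t) * besselEntire ν (B * t))))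
    (g := fun t => (B - A) * (besselEntire ν (A * t) * besselEntire ν (B * t)))
    (by fun_prop) (by fun_prop) ?_
  · simp only [mul_one, hA, hB, Real.one_rpow, Real.zero_rpow (by positivity : ν + 1 ≠ 0), zero_mul,
      mul_zero, sub_self, mul_left_comm _ (B - A), intervalIntegral.integral_const_mul] at key
    have h1 : B - A ≠ 0 := sub_ne_zero.2 hAB.symm
    simpa [h1, hσ.ne'] using key
  · intro t ht
    have rA := besselEntire_recurrence hν (A * t)
    have rB := besselEntire_recurrence hν (B * t)
    refine ((Real.hasDerivAt_rpow_const (p := ν + 1) (Or.inl ht.ne')).mul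
      ((((hasDerivAt_besselEntire_mul hν A t).mul
        (hasDerivAt_besselEntire_mul hν1 B t)).const_mul B).sub
      (((hasDerivAt_besselEntire_mul hν1 A t).mul
        (hasDerivAt_besselEntire_mul hν B t)).const_mul A))).congr_deriv ?_
    rw [add_sub_cancel_right, show ν + 1 + 1 = ν + 2 by ring, Real.rpow_add_one ht.ne']
    simp only [Pi.mul_apply, Pi.sub_apply]
    linear_combination (t ^ ν * A * besselEntire ν (B * t)) * rA -
      (t ^ ν * B * besselEntire ν (A * t)) * rB

theorem integral_besselEntire_sq {σ ν : ℝ} (hσ : 0 < σ) (hν : 0 ≤ ν) {A : ℝ}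
    (hA : besselEntire ν A = 0) :
    σ * ∫ x in (0 : ℝ)..1, x ^ (σ * (ν + 1) - 1) *
      (besselEntire ν (A * x ^ σ) * besselEntire ν (A * x ^ σ)) =
        A * besselEntire (ν + 1) A ^ 2 := by
  have hν1 : 0 ≤ ν + 1 := by positivity
  have cA := continuous_besselEntire_mul hν A
  have cA1 := continuous_besselEntire_mul hν1 A
  have cp : Continuous fun t : ℝ => t ^ (ν + 1) := Real.continuous_rpow_const hν1
  have key := integral_rpow_comp hσ hν
    (G := fun t => t ^ (ν + 1) * (t * (A * besselEntire (ν + 1) (A * t) ^ 2) +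
      (besselEntire ν (A * t) ^ 2 -
        ν * (besselEntire ν (A * t) * besselEntire (ν + 1) (A * t)))))
    (g := fun t => besselEntire ν (A * t) * besselEntire ν (A * t))
    (by fun_prop) (by fun_prop) ?_
  · rw [key]
    simp [hA, Real.zero_rpow (by positivity : ν + 1 ≠ 0)]
  · intro t ht
    have rA := besselEntire_recurrence hν (A * t)
    have d0 := hasDerivAt_besselEntire_mul hν A t
    have d1 := hasDerivAt_besselEntire_mul hν1 A t
    refine ((Real.hasDerivAt_rpow_const (p := ν + 1) (Or.inl ht.ne')).mul
      (((hasDerivAt_id t).mul ((d1.pow 2).const_mul A)).add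
      ((d0.pow 2).sub ((d0.mul d1).const_mul ν)))).congr_deriv ?_
    rw [add_sub_cancel_right, show ν + 1 + 1 = ν + 2 by ring, Real.rpow_add_one ht.ne']
    simp only [Pi.mul_apply, Pi.pow_apply, Pi.add_apply, Pi.sub_apply, id]
    push_cast
    linear_combination (t ^ ν * (ν * besselEntire ν (A * t) -
      2 * A * t * besselEntire (ν + 1) (A * t))) * rA

theorem coeFn_eigenvec {α : ℝ} (hα2 : α < 2) (β μ : ℝ) (k : ℕ) :
    eigenvec α β μ k =ᵐ[weightedMeasure β] eigenfun α β μ k := by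
  unfold eigenvec
  rw [dif_pos (memLp_eigenfun hα2 k)]
  exact MemLp.coeFn_toLp _

theorem inner_eigenvec {α : ℝ} (hα2 : α < 2) (β μ : ℝ) (i k : ℕ) :
    inner ℝ (eigenvec α β μ i) (eigenvec α β μ k) =
      eigenCoeff α β μ i * eigenCoeff α β μ k *
        ∫ x in (0 : ℝ)..1, x ^ (2 * kappa α * (nu α β μ + 1) - 1) *
          (besselEntire (nu α β μ) (entireZero (nu α β μ) i * x ^ (2 * kappa α)) *
            besselEntire (nu α β μ) (entireZero (nu α β μ) k * x ^ (2 * kappa α))) := by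
  have hκ := kappa_pos hα2
  have e1 : inner ℝ (eigenvec α β μ i) (eigenvec α β μ k) =
      ∫ x, eigenfun α β μ k x * eigenfun α β μ i x ∂weightedMeasure β := by
    rw [L2.inner_def]
    refine integral_congr_ae ?_
    filter_upwards [coeFn_eigenvec hα2 β μ i, coeFn_eigenvec hα2 β μ k] with x hi hk
    rw [hi, hk]
    rfl
  rw [e1, weightedMeasure, integral_withDensity_eq_integral_toReal_smul (by fun_prop) (by simp),
    ← intervalIntegral.integral_const_mul, intervalIntegral.integral_of_le zero_le_one,
    integral_Ioc_eq_integral_Ioo]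
  refine setIntegral_congr_fun measurableSet_Ioo fun x hx => ?_
  have hx0 : 0 < x := hx.1
  have e : kappa α * nu α β μ = Real.sqrt (muCrit (α + β) - μ) := by
    unfold nu
    field_simp
  have e2 : x ^ (2 * kappa α * (nu α β μ + 1) - 1) =
      x ^ β * (x ^ eigenExp α β μ * x ^ eigenExp α β μ) := by
    rw [← Real.rpow_add hx0, ← Real.rpow_add hx0]
    congr 1
    unfold eigenExp
    rw [← e]
    unfold kappa
    ring
  rw [ENNReal.toReal_ofReal (by positivity), eigenfun_eq hα2 β μ i hx0, eigenfun_eq hα2 β μ k hx0,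
    e2, smul_eq_mul]
  ring

theorem orthonormal_eigenvec {α : ℝ} (hα2 : α < 2) (β μ : ℝ) :
    Orthonormal ℝ (eigenvec α β μ) := by
  have hκ := kappa_pos hα2
  have hν := nu_nonneg hα2 β μ
  rw [orthonormal_iff_ite]
  intro i k
  rw [inner_eigenvec hα2]
  split_ifs with h
  · subst h
    have h1 := integral_besselEntire_sq (by positivity : 0 < 2 * kappa α) hν
      (besselEntire_entireZero hν i)
    have h2 := eigenCoeff_sq hα2 β μ i
    rw [← h1] at h2
    have h3 : 2 * kappa α ≠ 0 := by positivity
    refine mul_left_cancel₀ h3 ?_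
    linear_combination h2
  · rw [integral_besselEntire_mul_eq_zero (by positivity) hν
      ((entireZero_injective hν).ne h) (besselEntire_entireZero hν i)
      (besselEntire_entireZero hν k), mul_zero]

/-! ### Rapidly converging series of Bessel functions -/

/-- The sequence `d` decays faster than `exp (-R A_k)` for every `R`. -/
def SuperDecay (A d : ℕ → ℝ) : Prop := ∀ R : ℝ, Summable fun k => |d k| * Real.exp (R * A k)

theorem SuperDecay.summable {A d : ℕ → ℝ} (hd : SuperDecay A d) : Summable d := by
  refine Summable.of_norm ?_
  simpa using hd 0

theorem SuperDecay.mul {A d : ℕ → ℝ} (hA : ∀ k, 0 ≤ A k) (hd : SuperDecay A d) :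
    SuperDecay A fun k => A k * d k := by
  intro R
  refine Summable.of_nonneg_of_le (fun k => by positivity) (fun k => ?_) (hd (R + 1))
  rw [abs_mul, abs_of_nonneg (hA k), add_mul, one_mul, Real.exp_add]
  have h : A k ≤ Real.exp (A k) := by linarith [Real.add_one_le_exp (A k)]
  calc A k * |d k| * Real.exp (R * A k) ≤ Real.exp (A k) * |d k| * Real.exp (R * A k) := by gcongr
    _ = _ := by ring

theorem SuperDecay.const_mul {A d : ℕ → ℝ} (c : ℝ) (hd : SuperDecay A d) :
    SuperDecay A fun k => c * d k := by
  intro R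
  refine ((hd R).mul_left |c|).congr fun k => ?_
  rw [abs_mul]
  ring

/-- The function `y ↦ ∑ d_k h_ν(A_k y)`. -/
def besselSeries (A d : ℕ → ℝ) (ν y : ℝ) : ℝ := ∑' k, d k * besselEntire ν (A k * y)

section BesselSeries

variable {A d : ℕ → ℝ} {ν : ℝ}

theorem abs_besselSeries_term_le (hA : ∀ k, 0 ≤ A k) (hν : 0 ≤ ν) {R y : ℝ} (hy : |y| ≤ R) (k : ℕ) :
    |d k * besselEntire ν (A k * y)| ≤
      |d k| * Real.exp (R * A k) * (Real.Gamma (ν + 1))⁻¹ := by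
  have hG : 0 < Real.Gamma (ν + 1) := Real.Gamma_pos_of_pos (by positivity)
  rw [abs_mul, mul_assoc]
  refine mul_le_mul_of_nonneg_left ((abs_besselEntire_le hν _).trans ?_) (abs_nonneg _)
  gcongr
  rw [abs_mul, abs_of_nonneg (hA k), mul_comm]
  exact mul_le_mul_of_nonneg_right hy (hA k)

theorem summable_besselSeries (hA : ∀ k, 0 ≤ A k) (hν : 0 ≤ ν) (hd : SuperDecay A d) (y : ℝ) :
    Summable fun k => d k * besselEntire ν (A k * y) :=
  Summable.of_norm_bounded ((hd |y|).mul_right _) fun k =>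
    (Real.norm_eq_abs _).le.trans (abs_besselSeries_term_le hA hν le_rfl k)

theorem hasDerivAt_besselSeries (hA : ∀ k, 0 ≤ A k) (hν : 0 ≤ ν) (hd : SuperDecay A d) (y : ℝ) :
    HasDerivAt (besselSeries A d ν) (-besselSeries A (fun k => A k * d k) (ν + 1) y) y := by
  have hν1 : 0 ≤ ν + 1 := by positivity
  set R := |y| + 1
  have hy : y ∈ Metric.ball (0 : ℝ) R := by simp [R]
  have key := hasDerivAt_tsum_of_isPreconnected (𝕜 := ℝ)
    (g := fun k y => d k * besselEntire ν (A k * y))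
    (g' := fun k y => -(A k * d k * besselEntire (ν + 1) (A k * y)))
    (t := Metric.ball (0 : ℝ) R) (y₀ := y) (y := y) (((hd.mul hA) R).mul_right
    (Real.Gamma (ν + 1 + 1))⁻¹) Metric.isOpen_ball (convex_ball _ _).isPreconnected ?_ ?_ hy
    (summable_besselSeries hA hν hd y) hy
  · rw [tsum_neg] at key
    exact key
  · intro k z _
    refine ((hasDerivAt_besselEntire_mul hν (A k) z).const_mul (d k)).congr_deriv ?_
    ring
  · intro k z hz
    rw [norm_neg, Real.norm_eq_abs]
    exact abs_besselSeries_term_le (d := fun k => A k * d k) hA hν1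
      (by simpa using (mem_ball_zero_iff.1 hz).le) k

theorem contDiff_besselSeries (hA : ∀ k, 0 ≤ A k) (hν : 0 ≤ ν) (hd : SuperDecay A d) :
    ContDiff ℝ (⊤ : ℕ∞) (besselSeries A d ν) := by
  rw [contDiff_infty]
  intro n
  induction n generalizing ν d with
  | zero =>
    exact contDiff_zero.2 (continuous_iff_continuousAt.2 fun y =>
      (hasDerivAt_besselSeries hA hν hd y).continuousAt)
  | succ n ih =>
    push_cast
    rw [contDiff_succ_iff_deriv]
    refine ⟨fun y => (hasDerivAt_besselSeries hA hν hd y).differentiableAt, by simp, ?_⟩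
    rw [show deriv (besselSeries A d ν) = fun y =>
      -besselSeries A (fun k => A k * d k) (ν + 1) y from
        funext fun y => (hasDerivAt_besselSeries hA hν hd y).deriv]
    exact (ih (by positivity) (hd.mul hA)).neg

theorem besselSeries_zero : besselSeries A d ν 0 = (∑' k, d k) * (Real.Gamma (ν + 1))⁻¹ := by
  unfold besselSeries
  simp only [mul_zero, besselEntire_zero]
  rw [tsum_mul_right]

/-- The Bessel equation `y F'' + (ν+1) F' + A F = 0`, summed over all terms. -/
theorem besselSeries_recurrence (hA : ∀ k, 0 ≤ A k) (hν : 0 ≤ ν) (hd : SuperDecay A d) (y : ℝ) :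
    y * besselSeries A (fun k => A k * (A k * d k)) (ν + 2) y =
      (ν + 1) * besselSeries A (fun k => A k * d k) (ν + 1) y -
        besselSeries A (fun k => A k * d k) ν y := by
  have hν1 : 0 ≤ ν + 1 := by positivity
  unfold besselSeries
  rw [← tsum_mul_left, ← tsum_mul_left, ← Summable.tsum_sub
    ((summable_besselSeries hA hν1 (hd.mul hA) y).mul_left _)
    (summable_besselSeries hA hν (hd.mul hA) y)]
  refine tsum_congr fun k => ?_
  have h := besselEntire_recurrence hν (A k * y)
  linear_combination (A k * d k) * h

end BesselSeries

/-! ### The operator `𝓐` and the boundary functional on such series -/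

/-- The function `x ↦ x^p F(x^{2κ})`, where `p` is the exponent of the eigenfunctions. -/
def profile (α β μ : ℝ) (F : ℝ → ℝ) (x : ℝ) : ℝ := x ^ eigenExp α β μ * F (x ^ (2 * kappa α))

theorem contDiffOn_profile (α β μ : ℝ) {F : ℝ → ℝ} (hF : ContDiff ℝ (⊤ : ℕ∞) F) :
    ContDiffOn ℝ (⊤ : ℕ∞) (profile α β μ F) (Ioo 0 1) := by
  intro x hx
  have h (σ : ℝ) : ContDiffAt ℝ (⊤ : ℕ∞) (fun x : ℝ => x ^ σ) x :=
    Real.contDiffAt_rpow_const_of_ne hx.1.ne'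
  exact ((h _).mul (hF.contDiffAt.comp x (h _))).contDiffWithinAt

theorem hasDerivAt_profile {α β μ : ℝ} {F F' : ℝ → ℝ} (hF : ∀ y, HasDerivAt F (F' y) y)
    {x : ℝ} (hx : 0 < x) :
    HasDerivAt (profile α β μ F) (x ^ (eigenExp α β μ - 1) *
      (eigenExp α β μ * F (x ^ (2 * kappa α)) +
        2 * kappa α * x ^ (2 * kappa α) * F' (x ^ (2 * kappa α)))) x := by
  refine ((Real.hasDerivAt_rpow_const (p := eigenExp α β μ) (Or.inl hx.ne')).mul
    ((hF _).comp x (Real.hasDerivAt_rpow_const (p := 2 * kappa α) (Or.inl hx.ne')))).congr_deriv ?_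
  rw [Real.rpow_sub_one hx.ne', Real.rpow_sub_one hx.ne']
  simp only [Function.comp_apply]
  field_simp

theorem eigenExp_eq {α : ℝ} (hα2 : α < 2) (β μ : ℝ) :
    eigenExp α β μ = (1 - α - β) / 2 + kappa α * nu α β μ := by
  have hκ := kappa_pos hα2
  unfold eigenExp nu
  field_simp

/-- `p` is a root of the indicial equation. -/
theorem eigenExp_indicial {α β μ : ℝ} (hμ : μ < muCrit (α + β)) :
    eigenExp α β μ * (α + eigenExp α β μ - 1) + β * eigenExp α β μ + μ = 0 := by
  have h := Real.sq_sqrt (sub_pos.2 hμ).le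
  unfold eigenExp
  set r := Real.sqrt (muCrit (α + β) - μ)
  unfold muCrit at h
  linear_combination h

/-- In the variable `y = x^{2κ}`, the operator `𝓐` becomes `-4κ² (y ∂_y² + (ν+1) ∂_y)`. -/
theorem opA_profile {α β μ : ℝ} (hα2 : α < 2) (hμ : μ < muCrit (α + β)) {F F' F'' : ℝ → ℝ}
    (hF : ∀ y, HasDerivAt F (F' y) y) (hF' : ∀ y, HasDerivAt F' (F'' y) y) {x : ℝ} (hx : 0 < x) :
    opA α β μ (profile α β μ F) x = profile α β μ
      (fun y => -(2 * kappa α) ^ 2 * (y * F'' y + (nu α β μ + 1) * F' y)) x := by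
  have hind := eigenExp_indicial hμ
  have hp := eigenExp_eq hα2 β μ
  have hσ : 2 * kappa α = 2 - α := by unfold kappa; ring
  set p := eigenExp α β μ
  set σ := 2 * kappa α
  have h1 : ∀ y, 0 < y → deriv (profile α β μ F) y =
      y ^ (p - 1) * (p * F (y ^ σ) + σ * y ^ σ * F' (y ^ σ)) := fun y hy =>
    (hasDerivAt_profile hF hy).deriv
  have e1 : (fun y => y ^ α * deriv (profile α β μ F) y) =ᶠ[𝓝 x]
      fun y => p * (y ^ (α + p - 1) * F (y ^ σ)) + σ * (y ^ (p + 1) * F' (y ^ σ)) := by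
    filter_upwards [lt_mem_nhds hx] with y hy
    rw [h1 y hy, show p + 1 = α + (p - 1) + σ by rw [hσ]; ring,
      show α + p - 1 = α + (p - 1) by ring, Real.rpow_add hy (α + (p - 1)), Real.rpow_add hy α]
    ring
  have hpow : ∀ (G G' : ℝ → ℝ), (∀ y, HasDerivAt G (G' y) y) → HasDerivAt (fun y => G (y ^ σ))
      (G' (x ^ σ) * (σ * x ^ (σ - 1))) x := fun G G' hG =>
    (hG _).comp x (Real.hasDerivAt_rpow_const (Or.inl hx.ne'))
  have h2 : HasDerivAt (fun y => y ^ α * deriv (profile α β μ F) y)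
      (p * ((α + p - 1) * x ^ (α + p - 1 - 1) * F (x ^ σ) +
          x ^ (α + p - 1) * (F' (x ^ σ) * (σ * x ^ (σ - 1)))) +
        σ * ((p + 1) * x ^ (p + 1 - 1) * F' (x ^ σ) +
          x ^ (p + 1) * (F'' (x ^ σ) * (σ * x ^ (σ - 1))))) x := by
    refine HasDerivAt.congr_of_eventuallyEq ?_ e1
    exact (((Real.hasDerivAt_rpow_const (Or.inl hx.ne')).mul (hpow F F' hF)).const_mul p).add
      (((Real.hasDerivAt_rpow_const (Or.inl hx.ne')).mul (hpow F' F'' hF')).const_mul σ)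
  unfold opA
  rw [h2.deriv, h1 x hx]
  unfold profile
  have hσ0 : x ^ σ ≠ 0 := (Real.rpow_pos_of_pos hx _).ne'
  have ea : x ^ α = x ^ 2 / x ^ σ := by
    rw [eq_div_iff hσ0, ← Real.rpow_add hx, hσ, ← Real.rpow_natCast]
    congr 1
    push_cast
    ring
  have e2 : x ^ (2 - α) = x ^ σ := by rw [hσ]
  -- powers of `x` are reduced to `x^p`, `x^σ` and integer powers; then the factors of
  -- `F` and `F'` are matched by the indicial equation and by `2p + 1 + β = σ (ν+1)`
  rw [e2, show α + p - 1 - 1 = α + p - 2 by ring, show p + 1 - 1 = p by ring,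
    show α + p - 2 = α + p - (2 : ℕ) by push_cast; ring, Real.rpow_sub_natCast hx.ne',
    Real.rpow_sub_one hx.ne', Real.rpow_sub_one hx.ne', Real.rpow_sub_one hx.ne',
    Real.rpow_sub_one hx.ne', Real.rpow_add hx, Real.rpow_add_one hx.ne', ea]
  change _ = x ^ p * (-σ ^ 2 * (x ^ σ * F'' (x ^ σ) + (nu α β μ + 1) * F' (x ^ σ)))
  have hσν : 2 * p + 1 + β = σ * (nu α β μ + 1) := by
    rw [hp]
    change _ = 2 * kappa α * (nu α β μ + 1)
    unfold kappa
    ring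
  generalize x ^ σ = y at *
  generalize x ^ p = z at *
  field_simp
  linear_combination (-z * F y) * hind - (z * y * σ * F' y) * hσν

theorem opA_profile_besselSeries {α β μ : ℝ} (hα2 : α < 2) (hμ : μ < muCrit (α + β))
    {A d : ℕ → ℝ} (hA : ∀ k, 0 ≤ A k) (hd : SuperDecay A d) {x : ℝ} (hx : 0 < x) :
    opA α β μ (profile α β μ (besselSeries A d (nu α β μ))) x =
      profile α β μ (besselSeries A (fun k => (2 * kappa α) ^ 2 * (A k * d k)) (nu α β μ)) x := by
  have hν := nu_nonneg hα2 β μ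
  rw [opA_profile hα2 hμ (F' := fun y => -besselSeries A (fun k => A k * d k) (nu α β μ + 1) y)
    (F'' := fun y => besselSeries A (fun k => A k * (A k * d k)) (nu α β μ + 2) y)
    (hasDerivAt_besselSeries hA hν hd) ?_ hx]
  · unfold profile
    congr 1
    beta_reduce
    rw [besselSeries_recurrence hA hν hd]
    have : ∀ y, besselSeries A (fun k => (2 * kappa α) ^ 2 * (A k * d k)) (nu α β μ) y =
        (2 * kappa α) ^ 2 * besselSeries A (fun k => A k * d k) (nu α β μ) y := by
      intro y
      unfold besselSeries
      rw [← tsum_mul_left]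
      exact tsum_congr fun k => by ring
    rw [this]
    ring
  · intro y
    refine (hasDerivAt_besselSeries hA (by positivity : 0 ≤ nu α β μ + 1)
      (hd.mul hA) y).neg.congr_deriv ?_
    rw [neg_neg, show nu α β μ + 1 + 1 = nu α β μ + 2 by ring]

/-- The boundary functional extracts the value `F(0)` from `x^p F(x^{2κ})`, up to the factor `p`
which the derivative produces when `ℓ = 0`. -/
theorem hasGenLimit_profile {α β μ : ℝ} (hα2 : α < 2) {F F' : ℝ → ℝ}
    (hF : ∀ y, HasDerivAt F (F' y) y) (hF' : Continuous F') {u : ℝ → ℝ}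
    (hu : ∀ x, 0 < x → u x = profile α β μ F x) :
    HasGenLimit (α + β + gam α β μ - ell α β) (deriv^[1 - ell α β] u)
      (eigenExp α β μ ^ (1 - ell α β) * F 0) := by
  have hκ := kappa_pos hα2
  have hFc : Continuous F := continuous_iff_continuousAt.2 fun y => (hF y).continuousAt
  have hσ : Continuous fun x : ℝ => x ^ (2 * kappa α) :=
    Real.continuous_rpow_const (by positivity)
  have hσ0 : (0 : ℝ) ^ (2 * kappa α) = 0 := Real.zero_rpow (by positivity)
  have hexp : α + β + gam α β μ = 1 - eigenExp α β μ := by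
    unfold gam eigenExp
    ring
  unfold HasGenLimit
  rw [hexp]
  unfold ell
  split_ifs with h
  · have hc : Continuous fun x : ℝ => eigenExp α β μ * F (x ^ (2 * kappa α)) +
        2 * kappa α * x ^ (2 * kappa α) * F' (x ^ (2 * kappa α)) := by fun_prop
    have ht := (hc.tendsto 0).mono_left (nhdsWithin_le_nhds (s := Ioi 0))
    simp only [hσ0, mul_zero, zero_mul, add_zero] at ht
    simp only [Nat.sub_zero, Function.iterate_one, pow_one, Nat.cast_zero, sub_zero]
    refine ht.congr' ?_
    filter_upwards [self_mem_nhdsWithin] with x hx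
    have hx0 : 0 < x := hx
    have he : u =ᶠ[𝓝 x] profile α β μ F := by
      filter_upwards [lt_mem_nhds hx0] with y hy
      exact hu y hy
    rw [he.deriv_eq, (hasDerivAt_profile hF hx0).deriv, ← mul_assoc, ← Real.rpow_add hx0]
    rw [show 1 - eigenExp α β μ + (eigenExp α β μ - 1) = 0 by ring, Real.rpow_zero, one_mul]
  · have ht := ((hFc.comp hσ).tendsto 0).mono_left (nhdsWithin_le_nhds (s := Ioi 0))
    simp only [Function.comp_apply, hσ0] at ht
    simp only [Nat.sub_self, Function.iterate_zero, pow_zero, Nat.cast_one, id, one_mul]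
    refine ht.congr' ?_
    filter_upwards [self_mem_nhdsWithin] with x hx
    have hx0 : 0 < x := hx
    rw [hu x hx0, profile, ← mul_assoc, ← Real.rpow_add hx0]
    rw [show 1 - eigenExp α β μ - 1 + eigenExp α β μ = 0 by ring, Real.rpow_zero, one_mul]
    rfl

/-! ### Square summable sequences -/

/-- The real Hilbert space `ℓ²`. -/
abbrev SeqL2 : Type := lp (fun _ : ℕ => ℝ) 2

theorem memℓp_two_of_summable_sq {x : ℕ → ℝ} (hx : Summable fun k => x k ^ 2) : Memℓp x 2 := by
  refine memℓp_gen ?_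
  refine hx.congr fun k => ?_
  rw [ENNReal.toReal_ofNat, Real.rpow_two, Real.norm_eq_abs, sq_abs]

theorem SeqL2.summable_sq (x : SeqL2) : Summable fun k => x k ^ 2 := by
  refine ((lp.memℓp x).summable (by simp)).congr fun k => ?_
  rw [ENNReal.toReal_ofNat, Real.rpow_two, Real.norm_eq_abs, sq_abs]

theorem SeqL2.norm_sq (x : SeqL2) : ‖x‖ ^ 2 = ∑' k, x k ^ 2 := by
  have h := lp.norm_rpow_eq_tsum (p := 2) (by simp) x
  simpa using h

theorem SeqL2.norm_le {x : SeqL2} {g : ℕ → ℝ} (hg : Summable fun k => g k ^ 2) {c : ℝ}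
    (hc : 0 ≤ c) (h : ∀ k, |x k| ≤ g k * c) : ‖x‖ ≤ Real.sqrt (∑' k, g k ^ 2) * c := by
  refine le_of_sq_le_sq ?_ (by positivity)
  rw [mul_pow, Real.sq_sqrt (tsum_nonneg fun k => sq_nonneg _), SeqL2.norm_sq, ← tsum_mul_right]
  refine x.summable_sq.tsum_le_tsum (fun k => ?_) (hg.mul_right _)
  rw [← mul_pow, ← sq_abs (x k)]
  gcongr
  exact h k

/-- Dominated convergence in `ℓ²`. -/
theorem continuousOn_seqL2_of_dominated {F : ℝ → SeqL2} {S : Set ℝ} {g : ℕ → ℝ}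
    (hg : Summable fun k => g k ^ 2) (hF : ∀ k, ContinuousOn (fun τ => F τ k) S)
    (hb : ∀ τ ∈ S, ∀ k, |F τ k| ≤ g k) : ContinuousOn F S := by
  intro τ₀ h₀
  refine tendsto_iff_norm_sub_tendsto_zero.2 ?_
  have h1 : Tendsto (fun τ => ‖F τ - F τ₀‖ ^ 2) (𝓝[S] τ₀) (𝓝 0) := by
    simp only [SeqL2.norm_sq]
    rw [show (0 : ℝ) = ∑' _ : ℕ, (0 : ℝ) by simp]
    refine tendsto_tsum_of_dominated_convergence (bound := fun k => 4 * g k ^ 2)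
      (hg.mul_left 4) (fun k => ?_) ?_
    · have h : Tendsto (fun τ => F τ k) (𝓝[S] τ₀) (𝓝 (F τ₀ k)) := hF k τ₀ h₀
      simpa using (h.sub_const (F τ₀ k)).pow 2
    · filter_upwards [self_mem_nhdsWithin] with τ hτ k
      have h2 : |F τ k - F τ₀ k| ≤ 2 * g k := by
        have h3 := abs_sub (F τ k) (F τ₀ k)
        linarith [hb τ hτ k, hb τ₀ h₀ k]
      change |(F τ k - F τ₀ k) ^ 2| ≤ _
      rw [abs_pow]
      calc |F τ k - F τ₀ k| ^ 2 ≤ (2 * g k) ^ 2 := by gcongr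
        _ = _ := by ring
  have h2 := h1.sqrt
  simpa [Real.sqrt_sq_eq_abs] using h2

/-- The diagonal semigroup `x ↦ (e^{-λ_k² τ} x_k)_k` on `ℓ²`, with `τ` replaced by `max τ 0` so as to
be defined for all `τ`. -/
def decaySeq (l : ℕ → ℝ) (τ : ℝ) (x : SeqL2) : SeqL2 :=
  ⟨fun k => Real.exp (-(l k ^ 2) * max τ 0) * x k, by
    refine memℓp_two_of_summable_sq (Summable.of_nonneg_of_le (fun k => sq_nonneg _) (fun k => ?_)
      x.summable_sq)
    rw [mul_pow]
    refine mul_le_of_le_one_left (sq_nonneg _) (pow_le_one₀ (Real.exp_pos _).le ?_)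
    rw [Real.exp_le_one_iff, neg_mul, neg_nonpos]
    positivity⟩

theorem decaySeq_apply (l : ℕ → ℝ) (τ : ℝ) (x : SeqL2) (k : ℕ) :
    decaySeq l τ x k = Real.exp (-(l k ^ 2) * max τ 0) * x k := rfl

theorem abs_decaySeq_le (l : ℕ → ℝ) (τ : ℝ) (x : SeqL2) (k : ℕ) : |decaySeq l τ x k| ≤ |x k| := by
  rw [decaySeq_apply, abs_mul, Real.abs_exp]
  refine mul_le_of_le_one_left (abs_nonneg _) ?_
  rw [Real.exp_le_one_iff, neg_mul, neg_nonpos]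
  positivity

theorem norm_decaySeq_le (l : ℕ → ℝ) (τ : ℝ) (x : SeqL2) : ‖decaySeq l τ x‖ ≤ ‖x‖ :=
  lp.norm_mono (by simp) (abs_decaySeq_le l τ x)

theorem continuous_decaySeq (l : ℕ → ℝ) (x : SeqL2) : Continuous fun τ => decaySeq l τ x := by
  rw [← continuousOn_univ]
  refine continuousOn_seqL2_of_dominated (g := fun k => |x k|) ?_ (fun k => ?_)
    (fun τ _ k => abs_decaySeq_le l τ x k)
  · simpa using x.summable_sq
  · simp only [decaySeq_apply]
    fun_prop

theorem inner_decaySeq_comm (l : ℕ → ℝ) (τ : ℝ) (x y : SeqL2) :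
    inner ℝ (decaySeq l τ x) y = inner ℝ x (decaySeq l τ y) := by
  rw [← (lp.hasSum_inner _ _).tsum_eq, ← (lp.hasSum_inner _ _).tsum_eq]
  refine tsum_congr fun k => ?_
  rw [decaySeq_apply, decaySeq_apply]
  change y k * (Real.exp _ * x k) = Real.exp _ * y k * x k
  ring

/-! ### The control operator in `ℓ²` -/

/-- The function `t ↦ e^{-L(τ-t)}` on `(0,τ]`, extended by zero. -/
def decayKernel (L τ : ℝ) : ℝ → ℝ := (Ioc 0 τ).indicator fun t => Real.exp (-L * (τ - t))

theorem measurable_decayKernel (L τ : ℝ) : Measurable (decayKernel L τ) :=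
  Measurable.indicator (by fun_prop) measurableSet_Ioc

theorem decayKernel_sq_le (L τ t : ℝ) :
    decayKernel L τ t ^ 2 ≤ (Iic τ).indicator (fun t => Real.exp (-2 * L * τ) *
      Real.exp (2 * L * t)) t := by
  unfold decayKernel
  by_cases h : t ∈ Ioc 0 τ
  · rw [indicator_of_mem h, indicator_of_mem (show t ∈ Iic τ from h.2), ← Real.exp_nat_mul,
      ← Real.exp_add]
    refine le_of_eq ?_
    congr 1
    push_cast
    ring
  · rw [indicator_of_notMem h]
    simpa using indicator_nonneg (fun _ _ => by positivity) t

/-- The majorant lives on all of `(-∞, τ]`, so that no case distinction on `τ` is needed. -/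
theorem integrable_decayKernel_majorant {L : ℝ} (hL : 0 < L) (τ : ℝ) :
    Integrable ((Iic τ).indicator (fun t => Real.exp (-2 * L * τ) * Real.exp (2 * L * t))) :=
  IntegrableOn.integrable_indicator
    ((integrableOn_exp_mul_Iic (by positivity) τ).const_mul _) measurableSet_Iic

theorem memLp_decayKernel {L : ℝ} (hL : 0 < L) (τ T : ℝ) :
    MemLp (decayKernel L τ) 2 (volume.restrict (Ioo 0 T)) := by
  rw [memLp_two_iff_integrable_sq (measurable_decayKernel L τ).aestronglyMeasurable]
  refine ((integrable_decayKernel_majorant hL τ).restrict).mono'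
    ((measurable_decayKernel L τ).pow_const 2).aestronglyMeasurable (ae_of_all _ fun t => ?_)
  rw [Real.norm_eq_abs, abs_of_nonneg (sq_nonneg _)]
  exact decayKernel_sq_le L τ t

/-- `decayKernel` as an element of `L²(0,T)`. -/
def decayKernelLp {L : ℝ} (hL : 0 < L) (τ T : ℝ) : Control T := (memLp_decayKernel hL τ T).toLp

theorem norm_decayKernelLp_le {l : ℝ} (hl : 0 < l) (τ T : ℝ) :
    ‖decayKernelLp (pow_pos hl 2) τ T‖ ≤ l⁻¹ := by
  have hL : 0 < l ^ 2 := pow_pos hl 2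
  refine le_of_sq_le_sq ?_ (by positivity)
  rw [← real_inner_self_eq_norm_sq, L2.inner_def]
  have e : ∫ t, inner ℝ (decayKernelLp hL τ T t) (decayKernelLp hL τ T t)
      ∂(volume.restrict (Ioo 0 T)) = ∫ t in Ioo 0 T, decayKernel (l ^ 2) τ t ^ 2 := by
    refine integral_congr_ae ?_
    filter_upwards [MemLp.coeFn_toLp (memLp_decayKernel hL τ T)] with t ht
    unfold decayKernelLp
    rw [ht]
    exact (pow_two _).symm
  rw [e]
  calc ∫ t in Ioo 0 T, decayKernel (l ^ 2) τ t ^ 2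
      ≤ ∫ t in Ioo 0 T, (Iic τ).indicator
          (fun t => Real.exp (-2 * l ^ 2 * τ) * Real.exp (2 * l ^ 2 * t)) t := by
        refine integral_mono_of_nonneg (ae_of_all _ fun t => sq_nonneg _)
          (integrable_decayKernel_majorant hL τ).restrict
          (ae_of_all _ fun t => decayKernel_sq_le _ τ t)
    _ ≤ ∫ t, (Iic τ).indicator
          (fun t => Real.exp (-2 * l ^ 2 * τ) * Real.exp (2 * l ^ 2 * t)) t :=
        setIntegral_le_integral (integrable_decayKernel_majorant hL τ)
          (ae_of_all _ fun t => indicator_nonneg (fun _ _ => by positivity) t)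
    _ = (2 * l ^ 2)⁻¹ := by
        rw [integral_indicator measurableSet_Iic, integral_const_mul,
          integral_exp_mul_Iic (by positivity), mul_div_assoc', ← Real.exp_add,
          show -2 * l ^ 2 * τ + 2 * l ^ 2 * τ = 0 by ring, Real.exp_zero, one_div]
    _ ≤ l⁻¹ ^ 2 := by
        rw [inv_pow]
        gcongr
        linarith

theorem inner_decayKernelLp {L : ℝ} (hL : 0 < L) {τ T : ℝ} (hτ : τ ∈ Icc 0 T) (f : Control T) :
    inner ℝ (decayKernelLp hL τ T) f = ∫ t in (0 : ℝ)..τ, f t * Real.exp (-L * (τ - t)) := by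
  rw [L2.inner_def]
  have e : ∫ t, inner ℝ (decayKernelLp hL τ T t) (f t) ∂(volume.restrict (Ioo 0 T)) =
      ∫ t in Ioo 0 T, (Ioc 0 τ).indicator (fun t => f t * Real.exp (-L * (τ - t))) t := by
    refine integral_congr_ae ?_
    filter_upwards [MemLp.coeFn_toLp (memLp_decayKernel hL τ T)] with t ht
    unfold decayKernelLp
    rw [ht]
    change f t * decayKernel L τ t = _
    unfold decayKernel
    by_cases h : t ∈ Ioc 0 τ
    · rw [indicator_of_mem h, indicator_of_mem h]
    · rw [indicator_of_notMem h, indicator_of_notMem h, mul_zero]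
  rw [e, ← integral_Ioc_eq_integral_Ioo, setIntegral_indicator measurableSet_Ioc,
    inter_eq_self_of_subset_right (Ioc_subset_Ioc_right hτ.2),
    intervalIntegral.integral_of_le hτ.1]

theorem Control.integrableOn {T : ℝ} (f : Control T) : IntegrableOn f (Icc 0 T) := by
  rw [integrableOn_Icc_iff_integrableOn_Ioo]
  exact (Lp.memLp f).integrable (by norm_num)

theorem continuousOn_inner_decayKernelLp {L : ℝ} (hL : 0 < L) {T : ℝ} (f : Control T) :
    ContinuousOn (fun τ => inner ℝ (decayKernelLp hL τ T) f) (Icc 0 T) := by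
  have h1 : IntegrableOn (fun t => f t * Real.exp (L * t)) (Icc 0 T) :=
    f.integrableOn.mul_continuousOn (by fun_prop) isCompact_Icc
  have h2 := intervalIntegral.continuousOn_primitive_Icc h1
  have h3 : ContinuousOn (fun τ => Real.exp (-L * τ) *
      ∫ t in Icc 0 τ, f t * Real.exp (L * t)) (Icc 0 T) :=
    ContinuousOn.mul (by fun_prop) h2
  refine h3.congr fun τ hτ => ?_
  beta_reduce
  rw [inner_decayKernelLp hL hτ, integral_Icc_eq_integral_Ioc,
    ← intervalIntegral.integral_of_le hτ.1, ← intervalIntegral.integral_const_mul]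
  refine intervalIntegral.integral_congr fun t _ => ?_
  rw [show -L * (τ - t) = -L * τ + L * t by ring, Real.exp_add]
  ring

theorem abs_control_coord_le {l : ℝ} (hl : 0 < l) (w τ : ℝ) {T : ℝ} (f : Control T) :
    |w * inner ℝ (decayKernelLp (pow_pos hl 2) τ T) f| ≤ |w| / l * ‖f‖ := by
  rw [abs_mul, div_eq_mul_inv, mul_assoc]
  refine mul_le_mul_of_nonneg_left ((abs_real_inner_le_norm _ _).trans ?_) (abs_nonneg _)
  gcongr
  exact norm_decayKernelLp_le hl τ T

/-- The operator `f ↦ (w_k ∫₀^τ f(t) e^{-λ_k²(τ-t)} dt)_k` from `L²(0,T)` to `ℓ²`, for `τ ∈ [0,T]`;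
it is bounded if `w_k / λ_k` is square summable. -/
def controlSeq {l w : ℕ → ℝ} (hl : ∀ k, 0 < l k) (hw : Summable fun k => (|w k| / l k) ^ 2)
    (T τ : ℝ) : Control T →L[ℝ] SeqL2 :=
  LinearMap.mkContinuous
    { toFun := fun f =>
        ⟨fun k => w k * inner ℝ (decayKernelLp (pow_pos (hl k) 2) τ T) f, by
          refine memℓp_two_of_summable_sq (Summable.of_nonneg_of_le (fun k => sq_nonneg _)
            (fun k => ?_) (hw.mul_right (‖f‖ ^ 2)))
          rw [← mul_pow, ← sq_abs]
          gcongr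
          exact abs_control_coord_le (hl k) (w k) τ f⟩
      map_add' := fun f g => by
        ext k
        change w k * inner ℝ _ (f + g) = w k * inner ℝ _ f + w k * inner ℝ _ g
        rw [inner_add_right, mul_add]
      map_smul' := fun c f => by
        ext k
        change w k * inner ℝ _ (c • f) = c * (w k * inner ℝ _ f)
        rw [inner_smul_right]
        ring }
    (Real.sqrt (∑' k, (|w k| / l k) ^ 2))
    fun f => SeqL2.norm_le hw (norm_nonneg f) fun k => abs_control_coord_le (hl k) (w k) τ f

section ControlSeq

variable {l w : ℕ → ℝ} (hl : ∀ k, 0 < l k) (hw : Summable fun k => (|w k| / l k) ^ 2) (T : ℝ)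

theorem controlSeq_apply (τ : ℝ) (f : Control T) (k : ℕ) :
    controlSeq hl hw T τ f k = w k * inner ℝ (decayKernelLp (pow_pos (hl k) 2) τ T) f := rfl

theorem norm_controlSeq_le (τ : ℝ) (f : Control T) :
    ‖controlSeq hl hw T τ f‖ ≤ Real.sqrt (∑' k, (|w k| / l k) ^ 2) * ‖f‖ :=
  SeqL2.norm_le hw (norm_nonneg f) fun k => abs_control_coord_le (hl k) (w k) τ f

theorem continuousOn_controlSeq (f : Control T) :
    ContinuousOn (fun τ => controlSeq hl hw T τ f) (Icc 0 T) := by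
  refine continuousOn_seqL2_of_dominated (g := fun k => |w k| / l k * ‖f‖) ?_ (fun k => ?_)
    (fun τ _ k => abs_control_coord_le (hl k) (w k) τ f)
  · simpa only [mul_pow] using hw.mul_right (‖f‖ ^ 2)
  · exact continuousOn_const.mul (continuousOn_inner_decayKernelLp _ f)

end ControlSeq

/-! ### The isometries `𝓗^s ≃ ℓ²` and `𝓗^{-s} ≃ ℓ²` -/

section Isometry

variable {α β μ s : ℝ}

theorem eigenvalue_eq (α β μ : ℝ) (k : ℕ) :
    eigenvalue α β μ k = (2 * kappa α) ^ 2 * entireZero (nu α β μ) k := by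
  unfold eigenvalue entireZero
  ring

theorem eigenvalue_pos (hα2 : α < 2) (β μ : ℝ) (k : ℕ) : 0 < eigenvalue α β μ k := by
  have hκ := kappa_pos hα2
  have := entireZero_pos (nu_nonneg hα2 β μ) k
  rw [eigenvalue_eq]
  positivity

theorem eigenvalue_zero_le (hα2 : α < 2) (β μ : ℝ) (k : ℕ) :
    eigenvalue α β μ 0 ≤ eigenvalue α β μ k := by
  have hν := nu_nonneg hα2 β μ
  unfold eigenvalue
  have h1 := (besselZero_strictMono hν).monotone (Nat.zero_le k)
  have h2 := (besselZero_pos hν 0).le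
  gcongr

/-- A convergent expansion in the `Φ_k` has the expected coefficients. -/
theorem inner_eigenvec_of_hasSum (hα2 : α < 2) {c : ℕ → ℝ} {v : L2w β}
    (h : HasSum (fun k => c k • eigenvec α β μ k) v) (i : ℕ) :
    inner ℝ (eigenvec α β μ i) v = c i := by
  have h1 := h.mapL (innerSL ℝ (eigenvec α β μ i))
  have hon := orthonormal_iff_ite.1 (orthonormal_eigenvec hα2 β μ)
  have h2 : HasSum (fun k => innerSL ℝ (eigenvec α β μ i) (c k • eigenvec α β μ k)) (c i) := by
    convert hasSum_single (f := fun k => innerSL ℝ (eigenvec α β μ i) (c k • eigenvec α β μ k)) i ?_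
      using 1
    · rw [innerSL_apply_apply, inner_smul_right, hon, if_pos rfl, mul_one]
    · intro k hk
      rw [innerSL_apply_apply, inner_smul_right, hon, if_neg hk.symm, mul_zero]
  exact h1.unique h2

theorem summable_smul_eigenvec (hα2 : α < 2) (β μ : ℝ) {c : ℕ → ℝ}
    (hc : Summable fun k => c k ^ 2) : Summable fun k => c k • eigenvec α β μ k := by
  have h := ((orthonormal_eigenvec hα2 β μ).orthogonalFamily.summable_iff_norm_sq_summable c).2
    (by simpa using hc)
  simpa using h

theorem toSeq_injective (hα2 : α < 2) :
    Function.Injective (HSpace.toSeq : HSpace α β μ s →ₗ[ℝ] SeqL2) := by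
  rw [injective_iff_map_eq_zero]
  intro u hu
  have h1 : ∀ k, inner ℝ (eigenvec α β μ k) u.toL2 = 0 := by
    intro k
    have h2 : eigenvalue α β μ k ^ s * inner ℝ (eigenvec α β μ k) u.toL2 = 0 :=
      congrArg (fun x : SeqL2 => x k) hu
    have h3 : eigenvalue α β μ k ^ s ≠ 0 := (Real.rpow_pos_of_pos (eigenvalue_pos hα2 β μ k) s).ne'
    exact (mul_eq_zero.1 h2).resolve_left h3
  have h4 := HSpace.hasSum_toL2 u
  simp only [h1, zero_smul] at h4
  exact Subtype.ext (h4.unique hasSum_zero)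

theorem toSeq_surjective (hα2 : α < 2) (hs : 0 ≤ s) :
    Function.Surjective (HSpace.toSeq : HSpace α β μ s →ₗ[ℝ] SeqL2) := by
  intro x
  have hpos := eigenvalue_pos hα2 β μ
  set c : ℕ → ℝ := fun k => (eigenvalue α β μ k ^ s)⁻¹ * x k
  have hc : Summable fun k => c k ^ 2 := by
    refine Summable.of_nonneg_of_le (fun k => sq_nonneg _) (fun k => ?_)
      ((SeqL2.summable_sq x).mul_left ((eigenvalue α β μ 0 ^ s)⁻¹ ^ 2))
    have h0 := hpos 0
    have hk := hpos k
    simp only [c, mul_pow]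
    gcongr
    exact eigenvalue_zero_le hα2 β μ k
  obtain ⟨v, hv⟩ := summable_smul_eigenvec hα2 β μ hc
  have hcoef := inner_eigenvec_of_hasSum hα2 hv
  have hmul : ∀ k, eigenvalue α β μ k ^ s * c k = x k := fun k => by
    have := (Real.rpow_pos_of_pos (hpos k) s).ne'
    simp only [c]
    field_simp
  refine ⟨⟨v, ?_, ?_⟩, ?_⟩
  · simpa only [hcoef] using hv
  · simp only [hcoef]
    refine (SeqL2.summable_sq x).congr fun k => ?_
    rw [← hmul k, mul_pow, sq_abs, mul_comm 2 s, Real.rpow_mul (hpos k).le, Real.rpow_two]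
    ring
  · ext k
    change eigenvalue α β μ k ^ s * inner ℝ (eigenvec α β μ k) v = x k
    rw [hcoef, hmul]

/-- `u ↦ (λ_k^s a_k)_k` as an isometry of `𝓗^s` onto `ℓ²`. -/
def seqEquiv (hα2 : α < 2) (hs : 0 ≤ s) (β μ : ℝ) : HSpace α β μ s ≃ₗᵢ[ℝ] SeqL2 where
  toLinearEquiv := LinearEquiv.ofBijective HSpace.toSeq
    ⟨toSeq_injective hα2, toSeq_surjective hα2 hs⟩
  norm_map' _ := rfl

theorem seqEquiv_apply (hα2 : α < 2) (hs : 0 ≤ s) (u : HSpace α β μ s) (k : ℕ) :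
    seqEquiv hα2 hs β μ u k = eigenvalue α β μ k ^ s * inner ℝ (eigenvec α β μ k) u.toL2 := rfl

/-- The element of `𝓗^{-s}` given by a sequence in `ℓ²`. -/
def dualOfSeq (hα2 : α < 2) (hs : 0 ≤ s) (β μ : ℝ) : SeqL2 →L[ℝ] HDual α β μ s :=
  ((ContinuousLinearMap.compL ℝ (HSpace α β μ s) SeqL2 ℝ).flip
    (seqEquiv hα2 hs β μ : HSpace α β μ s →L[ℝ] SeqL2)).comp (innerSL ℝ)

theorem dualOfSeq_apply (hα2 : α < 2) (hs : 0 ≤ s) (y : SeqL2) (z : HSpace α β μ s) :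
    dualOfSeq hα2 hs β μ y z = inner ℝ y (seqEquiv hα2 hs β μ z) := rfl

theorem norm_dualOfSeq_le (hα2 : α < 2) (hs : 0 ≤ s) (y : SeqL2) :
    ‖dualOfSeq hα2 hs β μ y‖ ≤ ‖y‖ := by
  refine ContinuousLinearMap.opNorm_le_bound _ (norm_nonneg y) fun z => ?_
  rw [dualOfSeq_apply]
  refine (norm_inner_le_norm _ _).trans ?_
  rw [(seqEquiv hα2 hs β μ).norm_map]

/-- Riesz representation of `𝓗^{-s}` by `ℓ²`. -/
theorem exists_eq_dualOfSeq (hα2 : α < 2) (hs : 0 ≤ s) (u : HDual α β μ s) :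
    ∃ y : SeqL2, dualOfSeq hα2 hs β μ y = u ∧ ‖y‖ ≤ ‖u‖ := by
  set e := seqEquiv hα2 hs β μ
  set φ : StrongDual ℝ SeqL2 := u.comp (e.symm : SeqL2 →L[ℝ] HSpace α β μ s)
  refine ⟨(InnerProductSpace.toDual ℝ SeqL2).symm φ, ?_, ?_⟩
  · ext z
    rw [dualOfSeq_apply, InnerProductSpace.toDual_symm_apply]
    change u (e.symm (e z)) = u z
    rw [e.symm_apply_apply]
  · rw [LinearIsometryEquiv.norm_map]
    refine ContinuousLinearMap.opNorm_le_bound _ (norm_nonneg u) fun x => ?_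
    refine (u.le_opNorm _).trans ?_
    change ‖u‖ * ‖e.symm x‖ ≤ _
    rw [e.symm.norm_map]

theorem hasSum_dualOfSeq (hα2 : α < 2) (hs : 0 ≤ s) (y : SeqL2) (z : HSpace α β μ s) :
    HasSum (fun k => y k * (eigenvalue α β μ k ^ s * inner ℝ (eigenvec α β μ k) z.toL2))
      (dualOfSeq hα2 hs β μ y z) := by
  rw [dualOfSeq_apply]
  refine (lp.hasSum_inner y (seqEquiv hα2 hs β μ z)).congr_fun fun k => ?_
  rw [← seqEquiv_apply hα2 hs z k]
  exact mul_comm _ _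

theorem hasDualExpansion_dualOfSeq (hα2 : α < 2) (hs : 0 ≤ s) (y : SeqL2) :
    HasDualExpansion α β μ s (fun k => y k * eigenvalue α β μ k ^ s) (dualOfSeq hα2 hs β μ y) := by
  intro z
  simpa only [mul_assoc] using hasSum_dualOfSeq hα2 hs y z

/-- The element `S(τ) z` of `𝓗^s`, for `τ ≥ 0`. -/
def semigroup (hα2 : α < 2) (hs : 0 ≤ s) (τ : ℝ) (z : HSpace α β μ s) : HSpace α β μ s :=
  (seqEquiv hα2 hs β μ).symm (decaySeq (eigenvalue α β μ) τ (seqEquiv hα2 hs β μ z))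

theorem inner_eigenvec_semigroup (hα2 : α < 2) (hs : 0 ≤ s) {τ : ℝ} (hτ : 0 ≤ τ)
    (z : HSpace α β μ s) (k : ℕ) :
    inner ℝ (eigenvec α β μ k) (semigroup hα2 hs τ z).toL2 =
      Real.exp (-(eigenvalue α β μ k ^ 2) * τ) * inner ℝ (eigenvec α β μ k) z.toL2 := by
  have h1 : seqEquiv hα2 hs β μ (semigroup hα2 hs τ z) k =
      Real.exp (-(eigenvalue α β μ k ^ 2) * τ) * seqEquiv hα2 hs β μ z k := by
    unfold semigroup
    rw [LinearIsometryEquiv.apply_symm_apply, decaySeq_apply, max_eq_left hτ]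
  have h2 : eigenvalue α β μ k ^ s ≠ 0 := (Real.rpow_pos_of_pos (eigenvalue_pos hα2 β μ k) s).ne'
  rw [seqEquiv_apply, seqEquiv_apply] at h1
  refine mul_left_cancel₀ h2 ?_
  rw [h1]
  ring

theorem isSemigroup_semigroup (hα2 : α < 2) (hs : 0 ≤ s) {τ : ℝ} (hτ : 0 ≤ τ)
    (z : HSpace α β μ s) : IsSemigroup α β μ s τ z (semigroup hα2 hs τ z).toL2 := by
  have h := HSpace.hasSum_toL2 (semigroup hα2 hs τ z)
  simp only [inner_eigenvec_semigroup hα2 hs hτ z] at h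
  exact h

theorem dualOfSeq_decaySeq (hα2 : α < 2) (hs : 0 ≤ s) (τ : ℝ) (y : SeqL2) (z : HSpace α β μ s) :
    dualOfSeq hα2 hs β μ (decaySeq (eigenvalue α β μ) τ y) z =
      dualOfSeq hα2 hs β μ y (semigroup hα2 hs τ z) := by
  rw [dualOfSeq_apply, dualOfSeq_apply, inner_decaySeq_comm]
  unfold semigroup
  rw [LinearIsometryEquiv.apply_symm_apply]

theorem isDualSemigroup_dualOfSeq (hα2 : α < 2) (hs : 0 ≤ s) {τ : ℝ} (hτ : 0 ≤ τ) (y : SeqL2) :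
    IsDualSemigroup α β μ s τ (dualOfSeq hα2 hs β μ y)
      (dualOfSeq hα2 hs β μ (decaySeq (eigenvalue α β μ) τ y)) := by
  refine ⟨_, hasDualExpansion_dualOfSeq hα2 hs y, ?_⟩
  have h := hasDualExpansion_dualOfSeq (β := β) (μ := μ) hα2 hs (decaySeq (eigenvalue α β μ) τ y)
  simpa only [decaySeq_apply, max_eq_left hτ, mul_assoc] using h

end Isometry

/-! ### Size of the eigenfunctions and of the control coefficients -/

section Coefficients

variable {α : ℝ}

theorem eigenCoeff_nonneg (hα2 : α < 2) (β μ : ℝ) (k : ℕ) : 0 ≤ eigenCoeff α β μ k := by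
  have := besselZero_pos (nu_nonneg hα2 β μ) k
  unfold eigenCoeff
  positivity

/-- This is the lower bound on `|J_ν'|` at the zeros, through the normalization of `Φ_k`. -/
theorem exists_eigenCoeff_sq_le (hα2 : α < 2) (β μ : ℝ) : ∃ K, 0 ≤ K ∧ ∀ k,
    eigenCoeff α β μ k ^ 2 ≤ K * entireZero (nu α β μ) k ^ (nu α β μ + 1 / 2) := by
  have hκ := kappa_pos hα2
  have hν := nu_nonneg hα2 β μ
  obtain ⟨c, hc, h⟩ := exists_le_besselEntire_succ_entireZero hν
  refine ⟨2 * kappa α / c, by positivity, fun k => ?_⟩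
  have hz := entireZero_pos hν k
  have h1 := besselEntire_succ_entireZero_ne_zero hν k
  have h2 := eigenCoeff_sq hα2 β μ k
  have h3 := h k
  rw [show nu α β μ + 3 / 2 = nu α β μ + 1 / 2 + 1 by ring, Real.rpow_add_one hz.ne'] at h3
  rw [div_mul_eq_mul_div, le_div_iff₀ hc]
  calc eigenCoeff α β μ k ^ 2 * c ≤ eigenCoeff α β μ k ^ 2 *
        (entireZero (nu α β μ) k ^ (nu α β μ + 1 / 2) * entireZero (nu α β μ) k *
          besselEntire (nu α β μ + 1) (entireZero (nu α β μ) k) ^ 2) := by gcongr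
    _ = _ := by rw [← h2]; ring

theorem exists_eigenCoeff_le_exp (hα2 : α < 2) (β μ : ℝ) : ∃ K q, 0 ≤ K ∧ ∀ k,
    eigenCoeff α β μ k ≤ K * Real.exp (q * entireZero (nu α β μ) k) := by
  have hν := nu_nonneg hα2 β μ
  obtain ⟨K, hK, hCK⟩ := exists_eigenCoeff_sq_le hα2 β μ
  refine ⟨1 + K, nu α β μ + 1 / 2, by positivity, fun k => ?_⟩
  set q := nu α β μ + 1 / 2
  have hq : 0 ≤ q := by positivity
  set A := entireZero (nu α β μ) k
  have hA : 0 < A := entireZero_pos hν k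
  have hAq : A ^ q ≤ Real.exp (q * A) := by
    rw [Real.rpow_def_of_pos hA]
    refine Real.exp_le_exp.2 ?_
    have : Real.log A ≤ A := (Real.log_le_sub_one_of_pos hA).trans (by linarith)
    nlinarith
  have h1 : 1 ≤ Real.exp (q * A) := Real.one_le_exp (by positivity)
  have h2 : K * A ^ q ≤ K * Real.exp (q * A) := by gcongr
  have h3 : eigenCoeff α β μ k ^ 2 ≤ K * A ^ q := hCK k
  nlinarith [sq_nonneg (eigenCoeff α β μ k - 1)]

/-- The factor `e^{-λ_k² t}` beats everything that is exponential in `λ_k`. -/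
theorem superDecay_semigroup (hα2 : α < 2) (β μ : ℝ) {t M q : ℝ} (ht : 0 < t) {b : ℕ → ℝ}
    (hb : ∀ k, |b k| ≤ M * Real.exp (q * entireZero (nu α β μ) k)) :
    SuperDecay (entireZero (nu α β μ)) fun k =>
      Real.exp (-(eigenvalue α β μ k ^ 2) * t) * b k := by
  intro R
  have hκ := kappa_pos hα2
  have hν := nu_nonneg hα2 β μ
  obtain ⟨c, hc, hcA⟩ := exists_le_entireZero hν
  set σ := (2 * kappa α) ^ 2
  have hσ : 0 < σ := by positivity
  have hM : 0 ≤ M := nonneg_of_mul_nonneg_left ((abs_nonneg _).trans (hb 0)) (Real.exp_pos _)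
  have hgeo : Summable fun k : ℕ => Real.exp (k * -c) :=
    Real.summable_exp_nat_mul_iff.2 (by linarith)
  refine Summable.of_nonneg_of_le (fun k => by positivity) (fun k => ?_)
    (hgeo.mul_left (M * Real.exp ((q + R + 1) ^ 2 / (4 * (σ ^ 2 * t)))))
  set A := entireZero (nu α β μ) k
  have hck : (k : ℝ) * c ≤ A := by
    have h1 : c * ((k : ℝ) + 1) ^ 2 ≤ A := hcA k
    have h2 : (0 : ℝ) ≤ k := Nat.cast_nonneg k
    nlinarith [mul_nonneg hc.le h2, mul_nonneg hc.le (sq_nonneg (k : ℝ))]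
  have hquad : -((σ * A) ^ 2) * t + q * A + R * A ≤
      (q + R + 1) ^ 2 / (4 * (σ ^ 2 * t)) + k * -c := by
    have h1 : 0 < σ ^ 2 * t := by positivity
    have h2 : (q + R + 1) * A - σ ^ 2 * t * A ^ 2 ≤ (q + R + 1) ^ 2 / (4 * (σ ^ 2 * t)) := by
      rw [le_div_iff₀ (by positivity)]
      nlinarith [sq_nonneg (q + R + 1 - 2 * (σ ^ 2 * t) * A)]
    linarith
  rw [abs_mul, Real.abs_exp, eigenvalue_eq]
  calc Real.exp (-((σ * A) ^ 2) * t) * |b k| * Real.exp (R * A)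
      ≤ Real.exp (-((σ * A) ^ 2) * t) * (M * Real.exp (q * A)) * Real.exp (R * A) := by
        gcongr
        exact hb k
    _ = M * Real.exp (-((σ * A) ^ 2) * t + q * A + R * A) := by
        rw [Real.exp_add, Real.exp_add]
        ring
    _ ≤ M * Real.exp ((q + R + 1) ^ 2 / (4 * (σ ^ 2 * t)) + k * -c) :=
        mul_le_mul_of_nonneg_left (Real.exp_le_exp.2 hquad) hM
    _ = _ := by
        rw [Real.exp_add]
        ring

/-- The boundary value of `𝓐^{1-r} Φ_k`. -/
def controlCoeff (α β μ : ℝ) (r k : ℕ) : ℝ :=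
  eigenExp α β μ ^ (1 - ell α β) * (Real.Gamma (nu α β μ + 1))⁻¹ *
    (eigenvalue α β μ k ^ (1 - r) * eigenCoeff α β μ k)

/-- The admissibility of the control, where the hypothesis on `s` enters. -/
theorem summable_controlCoeff (hα2 : α < 2) (β μ : ℝ) {s : ℝ} {r : ℕ} (hr : r = 0 ∨ r = 1)
    (hs : (nu α β μ + 1) / 2 - r < s) : Summable fun k =>
      (|controlCoeff α β μ r k / eigenvalue α β μ k ^ s| / eigenvalue α β μ k) ^ 2 := by
  have hκ := kappa_pos hα2
  have hν := nu_nonneg hα2 β μ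
  obtain ⟨K, hK, hCK⟩ := exists_eigenCoeff_sq_le hα2 β μ
  obtain ⟨c, hc, hcA⟩ := exists_le_entireZero hν
  set σ := (2 * kappa α) ^ 2
  have hσ : 0 < σ := by positivity
  set P := eigenExp α β μ ^ (1 - ell α β) * (Real.Gamma (nu α β μ + 1))⁻¹
  -- the terms are `O(z_k^e)`, and `z_k` grows like `k²`
  set e : ℝ := nu α β μ + 1 / 2 + (-2 * r - 2 * s)
  have he : 2 * e < -1 := by
    simp only [e]
    linarith
  have hsum : Summable fun k : ℕ => ((k : ℝ) + 1) ^ (2 * e) := by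
    have := (summable_nat_add_iff 1).2 (Real.summable_nat_rpow.2 he)
    simpa using this
  refine Summable.of_nonneg_of_le (fun k => sq_nonneg _) (fun k => ?_)
    (hsum.mul_left (P ^ 2 * σ ^ (-2 * (r : ℝ) - 2 * s) * K * c ^ e))
  have hA := entireZero_pos hν k
  have hl := eigenvalue_pos hα2 β μ k
  have e1 : (|controlCoeff α β μ r k / eigenvalue α β μ k ^ s| / eigenvalue α β μ k) ^ 2 =
      P ^ 2 * eigenvalue α β μ k ^ (-2 * (r : ℝ) - 2 * s) * eigenCoeff α β μ k ^ 2 := by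
    have e2 : eigenvalue α β μ k ^ (-2 * (r : ℝ) - 2 * s) =
        (eigenvalue α β μ k ^ (1 - r) / eigenvalue α β μ k ^ s / eigenvalue α β μ k) ^ 2 := by
      rw [Real.rpow_sub hl, mul_comm 2 s, Real.rpow_mul hl.le s, Real.rpow_two, div_right_comm,
        div_pow _ (eigenvalue α β μ k ^ s)]
      congr 1
      rcases hr with rfl | rfl
      · have := hl.ne'
        simp [this]
      · rw [Nat.cast_one, mul_one, Real.rpow_neg hl.le, Real.rpow_two]
        simp
    rw [e2]
    unfold controlCoeff
    rw [div_pow, sq_abs]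
    ring
  have e3 : entireZero (nu α β μ) k ^ e ≤ c ^ e * ((k : ℝ) + 1) ^ (2 * e) := by
    have hk : (0 : ℝ) ≤ (k : ℝ) + 1 := by positivity
    rw [Real.rpow_mul hk, Real.rpow_two, ← Real.mul_rpow hc.le (sq_nonneg _)]
    exact Real.rpow_le_rpow_of_nonpos (by positivity) (hcA k) (by linarith)
  rw [e1]
  calc P ^ 2 * eigenvalue α β μ k ^ (-2 * (r : ℝ) - 2 * s) * eigenCoeff α β μ k ^ 2
      ≤ P ^ 2 * eigenvalue α β μ k ^ (-2 * (r : ℝ) - 2 * s) *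
          (K * entireZero (nu α β μ) k ^ (nu α β μ + 1 / 2)) := by
        gcongr
        exact hCK k
    _ = P ^ 2 * σ ^ (-2 * (r : ℝ) - 2 * s) * K * entireZero (nu α β μ) k ^ e := by
        rw [eigenvalue_eq, Real.mul_rpow hσ.le hA.le,
          show entireZero (nu α β μ) k ^ e = _ from Real.rpow_add hA _ _]
        ring
    _ ≤ P ^ 2 * σ ^ (-2 * (r : ℝ) - 2 * s) * K * (c ^ e * ((k : ℝ) + 1) ^ (2 * e)) := by gcongr
    _ = _ := by ring

end Coefficients

/-! ### Boundary values of `𝓐^{1-r} S(t) z` -/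

section BoundaryValue

variable {α β μ s : ℝ} {r : ℕ}

theorem ae_weightedMeasure_mem (β : ℝ) : ∀ᵐ x ∂weightedMeasure β, x ∈ Ioo (0 : ℝ) 1 :=
  (withDensity_absolutelyContinuous _ _).ae_le (ae_restrict_mem measurableSet_Ioo)

/-- A rapidly converging series of eigenfunctions is represented by the pointwise sum. -/
theorem ae_eq_profile_of_hasSum (hα2 : α < 2) {a : ℕ → ℝ} {v : L2w β}
    (hv : HasSum (fun k => a k • eigenvec α β μ k) v) (ha : Summable fun k => |a k|) :
    v =ᵐ[weightedMeasure β] profile α β μ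
      (besselSeries (entireZero (nu α β μ)) (fun k => a k * eigenCoeff α β μ k) (nu α β μ)) := by
  have hn : ∑' k, ‖a k • eigenvec α β μ k‖ₑ ≠ ⊤ := by
    refine tsum_enorm_ne_top_iff_summable_norm.2 (ha.congr fun k => ?_)
    rw [norm_smul, (orthonormal_eigenvec hα2 β μ).1 k, mul_one, Real.norm_eq_abs]
  have h1 := Lp.coeFn_tsum hn
  rw [hv.tsum_eq] at h1
  have h2 : ∀ᵐ x ∂weightedMeasure β, ∀ k, eigenvec α β μ k x = eigenfun α β μ k x :=
    ae_all_iff.2 fun k => coeFn_eigenvec hα2 β μ k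
  have h3 : ∀ᵐ x ∂weightedMeasure β, ∀ k,
      (a k • eigenvec α β μ k : L2w β) x = a k * eigenvec α β μ k x :=
    ae_all_iff.2 fun k => Lp.coeFn_smul (a k) (eigenvec α β μ k)
  filter_upwards [h1, h2, h3, ae_weightedMeasure_mem β] with x h1 h2 h3 hx
  rw [h1]
  unfold profile besselSeries
  rw [← tsum_mul_left]
  refine tsum_congr fun k => ?_
  rw [h3, h2, eigenfun_eq hα2 β μ k hx.1]
  ring

theorem hasBoundaryValue_semigroup (hα2 : α < 2) (hμ : μ < muCrit (α + β)) (hr : r = 0 ∨ r = 1)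
    {t : ℝ} (ht : 0 < t) {z : HSpace α β μ s} {v : L2w β} (hv : IsSemigroup α β μ s t z v) :
    HasBoundaryValue α β μ r v (∑' k, controlCoeff α β μ r k *
      (Real.exp (-(eigenvalue α β μ k ^ 2) * t) * inner ℝ (eigenvec α β μ k) z.toL2)) := by
  have hν := nu_nonneg hα2 β μ
  have hA : ∀ k, 0 ≤ entireZero (nu α β μ) k := fun k => (entireZero_pos hν k).le
  set a : ℕ → ℝ := fun k => inner ℝ (eigenvec α β μ k) z.toL2
  have ha : ∀ k, |a k| ≤ ‖z.toL2‖ := fun k => by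
    have := abs_real_inner_le_norm (eigenvec α β μ k) z.toL2
    rwa [(orthonormal_eigenvec hα2 β μ).1 k, one_mul] at this
  set d : ℕ → ℝ := fun k => Real.exp (-(eigenvalue α β μ k ^ 2) * t) * a k * eigenCoeff α β μ k
  have hd : SuperDecay (entireZero (nu α β μ)) d := by
    obtain ⟨K, q, hK, hC⟩ := exists_eigenCoeff_le_exp hα2 β μ
    have h := superDecay_semigroup hα2 β μ ht (b := fun k => a k * eigenCoeff α β μ k)
      (M := ‖z.toL2‖ * K) (q := q) fun k => by
        rw [abs_mul, abs_of_nonneg (eigenCoeff_nonneg hα2 β μ k), mul_assoc]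
        exact mul_le_mul (ha k) (hC k) (eigenCoeff_nonneg hα2 β μ k) (norm_nonneg _)
    simpa only [d, mul_assoc] using h
  have hsum : Summable fun k => |Real.exp (-(eigenvalue α β μ k ^ 2) * t) * a k| :=
    (superDecay_semigroup hα2 β μ ht (M := ‖z.toL2‖) (q := 0)
      fun k => by simpa using ha k).summable.abs
  refine ⟨profile α β μ (besselSeries (entireZero (nu α β μ)) d (nu α β μ)),
    contDiffOn_profile α β μ (contDiff_besselSeries hA hν hd), ae_eq_profile_of_hasSum hα2 hv hsum,
    ?_⟩
  have key : ∀ {d' : ℕ → ℝ}, SuperDecay (entireZero (nu α β μ)) d' →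
      (∀ k, d' k = eigenvalue α β μ k ^ (1 - r) * d k) → ∀ {u : ℝ → ℝ},
      (∀ x, 0 < x → u x =
        profile α β μ (besselSeries (entireZero (nu α β μ)) d' (nu α β μ)) x) →
      HasGenLimit (α + β + gam α β μ - ell α β) (deriv^[1 - ell α β] u)
        (∑' k, controlCoeff α β μ r k * (Real.exp (-(eigenvalue α β μ k ^ 2) * t) * a k)) := by
    intro d' hd' hdd' u hu
    have h1 := hasGenLimit_profile hα2 (hasDerivAt_besselSeries hA hν hd')
      (contDiff_besselSeries hA (by positivity : 0 ≤ nu α β μ + 1)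
        (hd'.mul hA)).continuous.neg hu
    convert h1 using 1
    rw [besselSeries_zero, ← tsum_mul_right, ← tsum_mul_left]
    refine tsum_congr fun k => ?_
    rw [hdd' k]
    simp only [d, controlCoeff]
    ring
  rcases hr with rfl | rfl
  · refine key ((hd.mul hA).const_mul ((2 * kappa α) ^ 2)) (fun k => ?_) fun x hx => ?_
    · rw [eigenvalue_eq]
      simp only [Nat.sub_zero, pow_one]
      ring
    · exact opA_profile_besselSeries hα2 hμ hA hd hx
  · exact key hd (fun k => by simp) fun x _ => rfl

theorem eqOn_deriv_Ioo {g g' : ℝ → ℝ} (h : EqOn g g' (Ioo 0 1)) :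
    EqOn (deriv g) (deriv g') (Ioo 0 1) := fun _ hx =>
  (h.eventuallyEq_of_mem (isOpen_Ioo.mem_nhds hx)).deriv_eq

theorem eqOn_opA_Ioo {g g' : ℝ → ℝ} (h : EqOn g g' (Ioo 0 1)) :
    EqOn (opA α β μ g) (opA α β μ g') (Ioo 0 1) := by
  have h1 := eqOn_deriv_Ioo h
  have h2 : EqOn (fun y => y ^ α * deriv g y) (fun y => y ^ α * deriv g' y) (Ioo 0 1) :=
    fun y hy => by simp only [h1 hy]
  intro x hx
  unfold opA
  rw [eqOn_deriv_Ioo h2 hx, h1 hx, h hx]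

/-- Boundary values do not depend on the choice of the smooth representative. -/
theorem HasBoundaryValue.unique {v : L2w β} {c c' : ℝ} (h : HasBoundaryValue α β μ r v c)
    (h' : HasBoundaryValue α β μ r v c') : c = c' := by
  obtain ⟨g, hg, hvg, hc⟩ := h
  obtain ⟨g', hg', hvg', hc'⟩ := h'
  have hae : g =ᵐ[volume.restrict (Ioo 0 1)] g' := by
    have h1 : volume.restrict (Ioo (0 : ℝ) 1) ≪ weightedMeasure β := by
      refine withDensity_absolutelyContinuous' (by fun_prop) ?_
      filter_upwards [ae_restrict_mem measurableSet_Ioo] with x hx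
      have := Real.rpow_pos_of_pos hx.1 β
      simpa using this
    exact h1.ae_le (hvg.symm.trans hvg')
  have heq : EqOn g g' (Ioo 0 1) :=
    Measure.eqOn_open_of_ae_eq hae isOpen_Ioo hg.continuousOn hg'.continuousOn
  have hit : ∀ (Q : (ℝ → ℝ) → ℝ → ℝ),
      (∀ {u u' : ℝ → ℝ}, EqOn u u' (Ioo 0 1) → EqOn (Q u) (Q u') (Ioo 0 1)) →
      ∀ (n : ℕ) {u u' : ℝ → ℝ}, EqOn u u' (Ioo 0 1) → EqOn (Q^[n] u) (Q^[n] u') (Ioo 0 1) := by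
    intro Q hQ n
    induction n with
    | zero => exact fun h => h
    | succ n ih => exact fun h => ih (hQ h)
  have h1 := hit deriv eqOn_deriv_Ioo (1 - ell α β) (hit (opA α β μ) eqOn_opA_Ioo (1 - r) heq)
  refine tendsto_nhds_unique hc (Tendsto.congr' ?_ hc')
  filter_upwards [Ioo_mem_nhdsGT (zero_lt_one (α := ℝ))] with x hx
  rw [h1 hx]

end BoundaryValue

/-! ### The boundary integral and weak solutions -/

/-- Companion of `hasSum_integral_of_summable_integral_norm`. -/
theorem integrable_tsum_of_summable_integral_norm {X : Type*} [MeasurableSpace X] {m : Measure X}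
    {F : ℕ → X → ℝ} (hF : ∀ k, Integrable (F k) m) (hs : Summable fun k => ∫ x, ‖F k x‖ ∂m) :
    Integrable (fun x => ∑' k, F k x) m := by
  have hn : ∑' k, ‖(hF k).toL1 (F k)‖ₑ ≠ ⊤ := by
    refine tsum_enorm_ne_top_iff_summable_norm.2 (hs.congr fun k => ?_)
    exact (L1.norm_of_fun_eq_integral_norm (hF k)).symm
  have h1 := Lp.coeFn_tsum hn
  refine (L1.integrable_coeFn (∑' k, (hF k).toL1 (F k))).congr (h1.trans ?_)
  have h2 : ∀ᵐ x ∂m, ∀ k, (hF k).toL1 (F k) x = F k x :=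
    ae_all_iff.2 fun k => (hF k).coeFn_toL1
  filter_upwards [h2] with x hx
  exact tsum_congr hx

section WeakSolution

variable {α β μ s T : ℝ} {r : ℕ}

/-- The operators `B_{ℓr}(τ)`. -/
def controlOp (hα2 : α < 2) (hs : 0 ≤ s) (β μ : ℝ) (hr : r = 0 ∨ r = 1)
    (hsr : (nu α β μ + 1) / 2 - r < s) (T τ : ℝ) : Control T →L[ℝ] HDual α β μ s :=
  (dualOfSeq hα2 hs β μ).comp
    (controlSeq (eigenvalue_pos hα2 β μ) (summable_controlCoeff hα2 β μ hr hsr) T τ)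

theorem controlOp_apply (hα2 : α < 2) (hs : 0 ≤ s) (hr : r = 0 ∨ r = 1)
    (hsr : (nu α β μ + 1) / 2 - r < s) (τ : ℝ) (f : Control T) :
    controlOp hα2 hs β μ hr hsr T τ f = dualOfSeq hα2 hs β μ (controlSeq (eigenvalue_pos hα2 β μ)
      (summable_controlCoeff hα2 β μ hr hsr) T τ f) := rfl

theorem integral_abs_mul_exp_le {l : ℝ} (hl : 0 < l) {τ : ℝ} (hτ : τ ∈ Icc 0 T) (f : Control T) :
    ∫ t in Ioc 0 τ, |f t| * Real.exp (-(l ^ 2) * (τ - t)) ≤ l⁻¹ * ‖f‖ := by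
  have h1 := inner_decayKernelLp (pow_pos hl 2) hτ |f|
  have h2 : ∫ t in Ioc 0 τ, |f t| * Real.exp (-(l ^ 2) * (τ - t)) =
      inner ℝ (decayKernelLp (pow_pos hl 2) τ T) |f| := by
    rw [h1, intervalIntegral.integral_of_le hτ.1]
    have h3 : ∀ᵐ t ∂volume.restrict (Ioc 0 T), (|f| : Control T) t = |f t| := by
      rw [← Measure.restrict_congr_set Ioo_ae_eq_Ioc]
      exact Lp.coeFn_abs f
    refine integral_congr_ae ?_
    filter_upwards [ae_restrict_of_ae_restrict_of_subset (Ioc_subset_Ioc_right hτ.2) h3] with t ht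
    rw [ht]
  rw [h2]
  refine (real_inner_le_norm _ _).trans ?_
  rw [norm_abs_eq_norm]
  gcongr
  exact norm_decayKernelLp_le hl τ T

theorem hasBoundaryIntegral_controlOp (hα2 : α < 2) (hμ : μ < muCrit (α + β)) (hs : 0 ≤ s)
    (hr : r = 0 ∨ r = 1) (hsr : (nu α β μ + 1) / 2 - r < s) {τ : ℝ} (hτ : τ ∈ Icc 0 T)
    (f : Control T) (z : HSpace α β μ s) :
    HasBoundaryIntegral α β μ s r τ f z (controlOp hα2 hs β μ hr hsr T τ f z) := by
  have hl := eigenvalue_pos hα2 β μ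
  set a : ℕ → ℝ := fun k => inner ℝ (eigenvec α β μ k) z.toL2
  set b : ℝ → ℝ := fun t => ∑' k, controlCoeff α β μ r k *
      (Real.exp (-(eigenvalue α β μ k ^ 2) * (τ - t)) * a k)
  set F : ℕ → ℝ → ℝ := fun k t => controlCoeff α β μ r k * a k *
      (f t * Real.exp (-(eigenvalue α β μ k ^ 2) * (τ - t)))
  have hFb : ∀ t, f t * b t = ∑' k, F k t := by
    intro t
    simp only [b, F]
    rw [← tsum_mul_left]
    exact tsum_congr fun k => by ring
  have hfint : IntegrableOn f (Icc 0 τ) := f.integrableOn.mono_set (Icc_subset_Icc_right hτ.2)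
  have hFint : ∀ k, IntegrableOn (F k) (Ioc 0 τ) := fun k =>
    ((hfint.mul_continuousOn (by fun_prop) isCompact_Icc).mono_set Ioc_subset_Icc_self).const_mul _
  have hw := summable_controlCoeff hα2 β μ hr hsr
  have hFsum : Summable fun k => ∫ t in Ioc 0 τ, ‖F k t‖ := by
    have h1 : Summable fun k => ‖f‖ *
        ((|controlCoeff α β μ r k / eigenvalue α β μ k ^ s| / eigenvalue α β μ k) ^ 2 +
          (seqEquiv hα2 hs β μ z k) ^ 2) :=
      (hw.add (SeqL2.summable_sq _)).mul_left _
    refine Summable.of_nonneg_of_le (fun k => integral_nonneg fun t => norm_nonneg _)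
      (fun k => ?_) h1
    have hls : 0 < eigenvalue α β μ k ^ s := Real.rpow_pos_of_pos (hl k) s
    have h2 : ∫ t in Ioc 0 τ, ‖F k t‖ = |controlCoeff α β μ r k * a k| *
        ∫ t in Ioc 0 τ, |f t| * Real.exp (-(eigenvalue α β μ k ^ 2) * (τ - t)) := by
      rw [← integral_const_mul]
      refine integral_congr_ae (ae_of_all _ fun t => ?_)
      simp only [F]
      rw [Real.norm_eq_abs, abs_mul, abs_mul (f t), Real.abs_exp]
    rw [h2]
    refine (mul_le_mul_of_nonneg_left (integral_abs_mul_exp_le (hl k) hτ f)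
      (abs_nonneg _)).trans ?_
    have h3 : |controlCoeff α β μ r k * a k| * ((eigenvalue α β μ k)⁻¹ * ‖f‖) = ‖f‖ *
        ((|controlCoeff α β μ r k / eigenvalue α β μ k ^ s| / eigenvalue α β μ k) *
          |seqEquiv hα2 hs β μ z k|) := by
      rw [seqEquiv_apply, abs_div, abs_mul, abs_mul, abs_of_pos hls]
      have := (hl k).ne'
      change _ = ‖f‖ * (_ * (_ * |a k|))
      field_simp
    rw [h3, ← sq_abs (seqEquiv hα2 hs β μ z k)]
    refine mul_le_mul_of_nonneg_left ?_ (norm_nonneg f)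
    set X := |controlCoeff α β μ r k / eigenvalue α β μ k ^ s| / eigenvalue α β μ k
    set Y := |seqEquiv hα2 hs β μ z k|
    nlinarith [sq_nonneg (X - Y), sq_nonneg X, sq_nonneg Y]
  refine ⟨b, fun t ht => ?_, ?_, ?_⟩
  · have ht' : 0 < τ - t := sub_pos.2 ht.2
    have hv := isSemigroup_semigroup hα2 hs ht'.le z
    exact ⟨_, hv, hasBoundaryValue_semigroup hα2 hμ hr ht' hv⟩
  · rw [intervalIntegrable_iff_integrableOn_Ioc_of_le hτ.1]
    simp only [hFb]
    exact integrable_tsum_of_summable_integral_norm hFint hFsum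
  · have h1 := hasSum_integral_of_summable_integral_norm hFint hFsum
    rw [intervalIntegral.integral_of_le hτ.1]
    simp only [hFb]
    rw [controlOp_apply]
    refine (hasSum_dualOfSeq hα2 hs _ z).unique ?_
    refine h1.congr_fun fun k => ?_
    rw [controlSeq_apply, inner_decayKernelLp _ hτ, intervalIntegral.integral_of_le hτ.1]
    simp only [F]
    rw [integral_const_mul]
    have : eigenvalue α β μ k ^ s ≠ 0 := (Real.rpow_pos_of_pos (hl k) s).ne'
    field_simp
    rfl

/-- The integrand is determined on `(0,τ)`: expansions in the `Φ_k` and boundary values are unique. -/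
theorem HasBoundaryIntegral.unique {τ : ℝ} (hτ : 0 ≤ τ) {f : Control T} {z : HSpace α β μ s}
    {I I' : ℝ} (h : HasBoundaryIntegral α β μ s r τ f z I)
    (h' : HasBoundaryIntegral α β μ s r τ f z I') : I = I' := by
  obtain ⟨b, hb, -, rfl⟩ := h
  obtain ⟨b', hb', -, rfl⟩ := h'
  rw [intervalIntegral.integral_of_le hτ, intervalIntegral.integral_of_le hτ,
    integral_Ioc_eq_integral_Ioo, integral_Ioc_eq_integral_Ioo]
  refine setIntegral_congr_fun measurableSet_Ioo fun t ht => ?_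
  obtain ⟨v, hv, hvb⟩ := hb t ht
  obtain ⟨v', hv', hvb'⟩ := hb' t ht
  obtain rfl : v = v' := HasSum.unique hv hv'
  simp only [hvb.unique hvb']

theorem WeakFormula.unique {τ : ℝ} (hτ : 0 ≤ τ) {u₀ : HDual α β μ s} {f : Control T}
    {w w' : HDual α β μ s} (h : WeakFormula α β μ s r u₀ f τ w)
    (h' : WeakFormula α β μ s r u₀ f τ w') : w = w' := by
  ext z
  obtain ⟨y, I, hy, hI, e⟩ := h z
  obtain ⟨y', I', hy', hI', e'⟩ := h' z
  obtain rfl : y = y' := Subtype.ext (HasSum.unique hy hy')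
  rw [e, e', hI.unique hτ hI']

/-- Two weak solutions coincide: they do so on `(0,T]` by the defining formula, and at `0` by
continuity. -/
theorem IsWeakSolution.eqOn (hT : 0 < T) {u₀ : HDual α β μ s} {f : Control T}
    {u v : ℝ → HDual α β μ s} (hu : IsWeakSolution α β μ s r u₀ f u)
    (hv : IsWeakSolution α β μ s r u₀ f v) : EqOn v u (Icc 0 T) := by
  have h : EqOn v u (Ioc 0 T) := fun τ hτ => (hv.2 τ hτ).unique hτ.1.le (hu.2 τ hτ)
  refine h.of_subset_closure hv.1 hu.1 Ioc_subset_Icc_self ?_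
  rw [closure_Ioc hT.ne]

/-- The weak solution, for `u₀` represented by the sequence `y`. -/
def weakSol (hα2 : α < 2) (hs : 0 ≤ s) (β μ : ℝ) (hr : r = 0 ∨ r = 1)
    (hsr : (nu α β μ + 1) / 2 - r < s) (y : SeqL2) (f : Control T) (τ : ℝ) : HDual α β μ s :=
  dualOfSeq hα2 hs β μ (decaySeq (eigenvalue α β μ) τ y) +
    (-1 : ℝ) ^ (1 - ell α β) • controlOp hα2 hs β μ hr hsr T τ f

theorem weakFormula_weakSol (hα2 : α < 2) (hμ : μ < muCrit (α + β)) (hs : 0 ≤ s)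
    (hr : r = 0 ∨ r = 1) (hsr : (nu α β μ + 1) / 2 - r < s) (y : SeqL2) (f : Control T) {τ : ℝ}
    (hτ : τ ∈ Icc 0 T) : WeakFormula α β μ s r (dualOfSeq hα2 hs β μ y) f τ
      (weakSol hα2 hs β μ hr hsr y f τ) := by
  intro z
  refine ⟨semigroup hα2 hs τ z, _, isSemigroup_semigroup hα2 hs hτ.1 z,
    hasBoundaryIntegral_controlOp hα2 hμ hs hr hsr hτ f z, ?_⟩
  rw [← dualOfSeq_decaySeq]
  rfl

theorem continuousOn_controlOp (hα2 : α < 2) (hs : 0 ≤ s) (hr : r = 0 ∨ r = 1)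
    (hsr : (nu α β μ + 1) / 2 - r < s) (f : Control T) :
    ContinuousOn (fun τ => controlOp hα2 hs β μ hr hsr T τ f) (Icc 0 T) :=
  (dualOfSeq hα2 hs β μ).continuous.comp_continuousOn (continuousOn_controlSeq _ _ T f)

theorem isWeakSolution_weakSol (hα2 : α < 2) (hμ : μ < muCrit (α + β)) (hs : 0 ≤ s)
    (hr : r = 0 ∨ r = 1) (hsr : (nu α β μ + 1) / 2 - r < s) (y : SeqL2) (f : Control T) :
    IsWeakSolution α β μ s r (dualOfSeq hα2 hs β μ y) f (weakSol hα2 hs β μ hr hsr y f) := by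
  refine ⟨?_, fun τ hτ => weakFormula_weakSol hα2 hμ hs hr hsr y f (Ioc_subset_Icc_self hτ)⟩
  refine ContinuousOn.add ?_
    ((continuous_const_smul _).comp_continuousOn (continuousOn_controlOp hα2 hs hr hsr f))
  exact ((dualOfSeq hα2 hs β μ).continuous.comp (continuous_decaySeq _ y)).continuousOn

theorem norm_weakSol_le (hα2 : α < 2) (hs : 0 ≤ s) (hr : r = 0 ∨ r = 1)
    (hsr : (nu α β μ + 1) / 2 - r < s) (y : SeqL2) (f : Control T) (τ : ℝ) :
    ‖weakSol hα2 hs β μ hr hsr y f τ‖ ≤ ‖y‖ + Real.sqrt (∑' k,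
      (|controlCoeff α β μ r k / eigenvalue α β μ k ^ s| / eigenvalue α β μ k) ^ 2) * ‖f‖ := by
  refine (norm_add_le _ _).trans (add_le_add ?_ ?_)
  · exact (norm_dualOfSeq_le hα2 hs _).trans (norm_decaySeq_le _ τ y)
  · rw [norm_smul, norm_pow, norm_neg, norm_one, one_pow, one_mul, controlOp_apply]
    exact (norm_dualOfSeq_le hα2 hs _).trans (norm_controlSeq_le _ _ T τ f)

end WeakSolution

end

end DegenerateFourthOrder

theorem proposition2p2 (T : ℝ) (hT : 0 < T) (α β μ s : ℝ) (r : ℕ)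
    (hα0 : 0 ≤ α) (hα2 : α < 2) (hαβ : α + β ≠ 1)
    (hμ : μ < DegenerateFourthOrder.muCrit (α + β)) (hr : r = 0 ∨ r = 1)
    (hs0 : 0 < s) (hs : (DegenerateFourthOrder.nu α β μ + 1) / 2 - r < s) :
    ∃ B : ℝ → (DegenerateFourthOrder.Control T →L[ℝ] DegenerateFourthOrder.HDual α β μ s),
      -- the family `B(τ)` is given by the boundary integral
      (∀ τ ∈ Icc 0 T, ∀ (f : DegenerateFourthOrder.Control T)
        (z : DegenerateFourthOrder.HSpace α β μ s),
        DegenerateFourthOrder.HasBoundaryIntegral α β μ s r τ f z (B τ f z)) ∧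
      -- and it is strongly continuous
      (∀ f : DegenerateFourthOrder.Control T, ContinuousOn (fun τ => B τ f) (Icc 0 T)) ∧
      (∀ (u₀ : DegenerateFourthOrder.HDual α β μ s) (f : DegenerateFourthOrder.Control T),
        ∃ u : ℝ → DegenerateFourthOrder.HDual α β μ s,
          -- for each `τ`, the formula defines a unique element `u(τ)`
          (∀ τ ∈ Icc 0 T, DegenerateFourthOrder.WeakFormula α β μ s r u₀ f τ (u τ) ∧
            ∀ w, DegenerateFourthOrder.WeakFormula α β μ s r u₀ f τ w → w = u τ) ∧
          -- `u(τ) = S(τ) u₀ + (-1)^{1-ℓ} B(τ) f`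
          (∀ τ ∈ Icc 0 T, ∃ w, DegenerateFourthOrder.IsDualSemigroup α β μ s τ u₀ w ∧
            u τ = w + (-1 : ℝ) ^ (1 - DegenerateFourthOrder.ell α β) • B τ f) ∧
          -- `u` is the unique weak solution, in particular continuous
          DegenerateFourthOrder.IsWeakSolution α β μ s r u₀ f u ∧
          ∀ v, DegenerateFourthOrder.IsWeakSolution α β μ s r u₀ f v → EqOn v u (Icc 0 T)) ∧
      -- bound of the weak solution, with a constant independent of `u₀` and `f`
      ∃ C : ℝ, 0 < C ∧ ∀ (u₀ : DegenerateFourthOrder.HDual α β μ s)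
        (f : DegenerateFourthOrder.Control T) (u : ℝ → DegenerateFourthOrder.HDual α β μ s),
        DegenerateFourthOrder.IsWeakSolution α β μ s r u₀ f u →
          ∀ τ ∈ Icc 0 T, ‖u τ‖ ≤ C * (‖u₀‖ + ‖f‖) := by
  refine ⟨DegenerateFourthOrder.controlOp hα2 hs0.le β μ hr hs T,
    fun τ hτ f z => DegenerateFourthOrder.hasBoundaryIntegral_controlOp hα2 hμ hs0.le hr hs hτ f z,
    DegenerateFourthOrder.continuousOn_controlOp hα2 hs0.le hr hs, fun u₀ f => ?_, ?_⟩
  · obtain ⟨y, rfl, -⟩ := DegenerateFourthOrder.exists_eq_dualOfSeq hα2 hs0.le u₀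
    have hu := DegenerateFourthOrder.isWeakSolution_weakSol hα2 hμ hs0.le hr hs y f
    refine ⟨DegenerateFourthOrder.weakSol hα2 hs0.le β μ hr hs y f, fun τ hτ => ?_, fun τ hτ => ?_,
      hu, fun v hv => hu.eqOn hT hv⟩
    · have h := DegenerateFourthOrder.weakFormula_weakSol hα2 hμ hs0.le hr hs y f hτ
      exact ⟨h, fun w hw => hw.unique hτ.1 h⟩
    · exact ⟨_, DegenerateFourthOrder.isDualSemigroup_dualOfSeq hα2 hs0.le hτ.1 y, rfl⟩
  · set M := Real.sqrt (∑' k, (|DegenerateFourthOrder.controlCoeff α β μ r k /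
      DegenerateFourthOrder.eigenvalue α β μ k ^ s| /
        DegenerateFourthOrder.eigenvalue α β μ k) ^ 2)
    have hM : 0 ≤ M := Real.sqrt_nonneg _
    refine ⟨1 + M, by positivity, fun u₀ f u hu τ hτ => ?_⟩
    obtain ⟨y, rfl, hy⟩ := DegenerateFourthOrder.exists_eq_dualOfSeq hα2 hs0.le u₀
    have h := DegenerateFourthOrder.isWeakSolution_weakSol hα2 hμ hs0.le hr hs y f
    rw [h.eqOn hT hu hτ]
    have h1 := DegenerateFourthOrder.norm_weakSol_le hα2 hs0.le hr hs y f τ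
    have h2 := norm_nonneg f
    have h3 := (norm_nonneg y).trans hy
    nlinarith [mul_nonneg hM h3]
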